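/- \textbf{Conventions.} For compact Hausdorff $X$, a ($d$-variable) \emph{weighted partial system} (WPS) $(\sigma,w)$ on $X$ consists of clopen sets $X_1,\dots,X_d\subseteq X$, continuous maps $\sigma_i:X_i\to X$ and continuous weights $w_i:X_i\to(0,\infty)$. Its graph is $Gr(\sigma)=\bigcup_i\{(\sigma_i(x),x): x\in X_i\}$; an edge $e=(y,x)$ has range $r(e)=y$, source $s(e)=x$ and weight $w(e)=\sum_{i:\,x\in X_i,\ \sigma_i(x)=y}w_i(x)$. A path of length $n$ is $\mu=\mu_n\cdots\mu_1$ with $\mu_k\in Gr(\sigma)$ and $r(\mu_k)=s(\mu_{k+1})$. $C(\sigma,w)$ is the C*-correspondence $C(Gr(\sigma))$ over $C(X)$ with $(f\cdot\xi\cdot g)(e)=f(r(e))\xi(e)g(s(e))$ and $\langle\xi,\eta\rangle(x)=\sum_{s(e)=x}\overline{\xi(e)}\,w(e)\,\eta(e)$. For a WPS $(\tau,u)$ on $Y$ and a homeomorphism $\gamma:X\to Y$, let $(\tau^\gamma,u^\gamma)$ be the WPS on $X$ with maps $\gamma^{-1}\tau_i\gamma$ and weights $u_i\gamma$ on $\gamma^{-1}(Y_i)$.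 $(\sigma,w)$ and $(\tau,u)$ are \emph{weighted-orbit conjugate via $\gamma$ with constant $C\ge1$} if $Gr(\sigma)=Gr(\tau^\gamma)$ and there is $H\in C(Gr(\sigma))$ such that $\frac1C\le\prod_{k=1}^n\frac{u^\gamma(\mu_k)}{w(\mu_k)}H(\mu_k)\le C$ for every $n\in\mathbb N$ and every path $\mu_n\cdots\mu_1$ in $Gr(\sigma)$. For a *-isomorphism $\rho:C(X)\to C(Y)$, a \emph{$\rho$-similarity} $V:E\to F$ between C*-correspondences over $C(X)$ and $C(Y)$ is a bounded linear bijection with $V(a\xi b)=\rho(a)V(\xi)\rho(b)$ such that $\sup_n\|V^{\otimes n}\|<\infty$ and $\sup_n\|(V^{-1})^{\otimes n}\|<\infty$, where $V^{\otimes n}:E^{\otimes n}\to F^{\otimes n}$ is the induced bounded operator on internal tensor powers; here $n\ge0$, $E^{\otimes0}=C(X)$ and $V^{\otimes0}=\rho$. \textbf{Proposition.} Let $(\sigma,w)$ and $(\tau,u)$ be WPS on non-empty compact Hausdorff spaces $X$ and $Y$, let $\gamma:X\to Y$ be a homeomorphism and let $\rho:C(X)\to C(Y)$, $\rho(f)=f\circ\gamma^{-1}$.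 \begin{enumerate} \item If $(\sigma,w)$ and $(\tau,u)$ are weighted-orbit conjugate via $\gamma$ with constant $C\ge1$, then there is a $\rho$-similarity $V:C(\sigma,w)\to C(\tau,u)$ with $\sup_n\max\{\|V^{\otimes n}\|^2,\|(V^{-1})^{\otimes n}\|^2\}\le C$. \item If $V:C(\sigma,w)\to C(\tau,u)$ is a $\rho$-similarity, then $(\sigma,w)$ and $(\tau,u)$ are weighted-orbit conjugate via $\gamma$ with constant $C=\sup_n\max\{\|V^{\otimes n}\|^2,\|(V^{-1})^{\otimes n}\|^2\}$. \end{enumerate} -/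

import Mathlib

open scoped TensorProduct ComplexOrder

universe u v

set_option linter.unusedSectionVars false

/-! ### Positive matrices over a C*-algebra (needed for positivity of the inner product on tensor
products) -/

theorem CStarGram.selfAdjoint_split {B : Type*} [CStarAlgebra B] (m : B) (hm : IsSelfAdjoint m) :
    ∃ N T : B, star N = N ∧ N * N * N = star T * T ∧ N * m * N = -(star T * T) ∧
      (N = 0 → ∃ s, m = star s * s) := by
  let _ := CStarAlgebra.spectralOrder B
  have _ := CStarAlgebra.spectralOrderedRing B
  have hN := CFC.negPart_nonneg m
  have hNs : star m⁻ = m⁻ := (IsSelfAdjoint.of_nonneg hN).star_eq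
  have h3 : 0 ≤ m⁻ * m⁻ * m⁻ := by
    have := star_left_conjugate_nonneg hN m⁻
    rwa [hNs] at this
  obtain ⟨T, hT⟩ := CStarAlgebra.nonneg_iff_eq_star_mul_self.mp h3
  refine ⟨m⁻, T, hNs, hT, ?_, fun h => ?_⟩
  · rw [← hT]
    calc m⁻ * m * m⁻ = m⁻ * (m⁺ - m⁻) * m⁻ := by rw [CFC.posPart_sub_negPart m hm]
      _ = _ := by rw [mul_sub, CFC.negPart_mul_posPart]; simp
  · apply CStarAlgebra.nonneg_iff_eq_star_mul_self.mp
    rw [← CFC.posPart_sub_negPart m hm, h, sub_zero]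
    exact CFC.posPart_nonneg m

theorem CStarGram.exists_factor {A : Type*} [CStarAlgebra A] [PartialOrder A] [StarOrderedRing A]
    {n : ℕ} (a : Fin n → Fin n → A)
    (hsymm : ∀ i j, star (a i j) = a j i)
    (hpos : ∀ c : Fin n → A, 0 ≤ ∑ i, ∑ j, star (c i) * a i j * c j) :
    ∃ b : Fin n → Fin n → A, ∀ i j, a i j = ∑ k, star (b k i) * b k j := by
  let M : CStarMatrix (Fin n) (Fin n) A := CStarMatrix.ofMatrix (Matrix.of a)
  have hsa : IsSelfAdjoint M := by
    ext i j
    simp [M, CStarMatrix.star_apply, hsymm]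
  have sq0 : ∀ N : CStarMatrix (Fin n) (Fin n) A, star N * N = 0 → N = 0 := fun N h =>
    (CStarRing.star_mul_self_eq_zero_iff N).1 h
  obtain ⟨N, B, hNs, h3, hNMN, hM⟩ := CStarGram.selfAdjoint_split M hsa
  have hBz : ∀ k i, B k i = 0 := by
    intro k i
    have h1 : 0 ≤ (N * M * N) i i := by
      have := hpos (fun k => N k i)
      convert this using 1
      rw [CStarMatrix.mul_apply]
      simp only [CStarMatrix.mul_apply, Finset.sum_mul]
      rw [Finset.sum_comm]
      refine Finset.sum_congr rfl fun p _ => Finset.sum_congr rfl fun q _ => ?_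
      have : N i p = star (N p i) := by
        conv_lhs => rw [← hNs]
        rfl
      rw [this]; rfl
    have h2 : (N * M * N) i i = -∑ k, star (B k i) * B k i := by
      refine (congrFun (congrFun hNMN i) i).trans ?_
      simp [CStarMatrix.mul_apply, CStarMatrix.star_apply]
    rw [h2, Left.nonneg_neg_iff] at h1
    have h4 : ∀ k ∈ Finset.univ, 0 ≤ star (B k i) * B k i := fun k _ => star_mul_self_nonneg _
    have h5 := (Finset.sum_eq_zero_iff_of_nonneg h4).1 (le_antisymm h1 (Finset.sum_nonneg h4)) k
      (Finset.mem_univ k)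
    exact CStarRing.star_mul_self_eq_zero_iff _ |>.1 h5
  have hB0 : B = 0 := by ext k i; exact hBz k i
  have h3' : N * N * N = 0 := by rw [h3, hB0]; exact mul_zero _
  have h2 : N * N = 0 := by
    apply sq0
    rw [star_mul, hNs, ← mul_assoc, h3', zero_mul]
  obtain ⟨S, hS⟩ := hM (sq0 N (by rw [hNs, h2]))
  refine ⟨fun k i => S k i, fun i j => ?_⟩
  have : M i j = (star S * S) i j := congrFun (congrFun hS i) j
  simpa [M, CStarMatrix.mul_apply, CStarMatrix.star_apply] using this

/-! ### Correspondences over `C(X)` -/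

/-- A correspondence over `C(X)`, before separation and completion: a complex vector space with
commuting unital left and right actions of `C(X)` and a positive `C(X)`-valued sesquilinear form
`⟨ξ, η⟩` (conjugate linear in `ξ`), such that the right action satisfies `⟨ξ, η·a⟩ = ⟨ξ, η⟩ a`
and the left action is by adjointable operators, `⟨a·ξ, η⟩ = ⟨ξ, a*·η⟩`.
The (semi)norm is `‖ξ‖ = ‖⟨ξ, ξ⟩‖^(1/2)`. A Hilbert C*-correspondence over `C(X)` is such an object
whose seminorm is a complete norm. -/
structure PreCorr (X : Type u) [TopologicalSpace X] [CompactSpace X] where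
  carrier : Type u
  [addCommGroup : AddCommGroup carrier]
  [module : Module ℂ carrier]
  left : C(X, ℂ) →ₐ[ℂ] Module.End ℂ carrier
  right : C(X, ℂ) →ₐ[ℂ] Module.End ℂ carrier
  inner : carrier →ₗ⋆[ℂ] carrier →ₗ[ℂ] C(X, ℂ)
  left_right : ∀ a b ξ, left a (right b ξ) = right b (left a ξ)
  inner_right : ∀ ξ η a, inner ξ (right a η) = inner ξ η * a
  inner_left : ∀ a ξ η, inner (left a ξ) η = inner ξ (left (star a) η)
  star_inner : ∀ ξ η, star (inner ξ η) = inner η ξ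
  inner_nonneg : ∀ ξ, 0 ≤ inner ξ ξ

namespace PreCorr

attribute [instance] PreCorr.addCommGroup PreCorr.module

variable {X : Type u} [TopologicalSpace X] [CompactSpace X]

theorem exists_factor {n : ℕ} (a : Fin n → Fin n → C(X, ℂ))
    (hsymm : ∀ i j, star (a i j) = a j i)
    (hpos : ∀ c : Fin n → C(X, ℂ), 0 ≤ ∑ i, ∑ j, star (c i) * a i j * c j) :
    ∃ b : Fin n → Fin n → C(X, ℂ), ∀ i j, a i j = ∑ k, star (b k i) * b k j :=
  CStarGram.exists_factor a hsymm hpos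

section Norm
variable (E : PreCorr X)

theorem inner_nonneg' (ξ : E.carrier) (x : X) : 0 ≤ E.inner ξ ξ x := E.inner_nonneg ξ x

theorem re_nonneg (ξ : E.carrier) (x : X) : 0 ≤ (E.inner ξ ξ x).re :=
  (Complex.nonneg_iff.mp (E.inner_nonneg' ξ x)).1

/-- The pre-inner product `(ξ, η) ↦ ⟨ξ, η⟩(x)`. -/
@[reducible] noncomputable def evalCore (x : X) : PreInnerProductSpace.Core ℂ E.carrier where
  inner ξ η := E.inner ξ η x
  conj_inner_symm ξ η := by
    rw [← E.star_inner η ξ]; simp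
  re_inner_nonneg ξ := E.re_nonneg ξ x
  add_left ξ η ζ := by simp
  smul_left ξ η c := by simp

/-- `‖ξ‖ = ‖⟨ξ, ξ⟩‖^(1/2)`. -/
noncomputable instance instNorm : Norm E.carrier := ⟨fun ξ => √‖E.inner ξ ξ‖⟩

theorem norm_def (ξ : E.carrier) : ‖ξ‖ = √‖E.inner ξ ξ‖ := rfl

theorem norm_nonneg' (ξ : E.carrier) : 0 ≤ ‖ξ‖ := Real.sqrt_nonneg _

theorem norm_inner_self (ξ : E.carrier) (x : X) : ‖E.inner ξ ξ x‖ = (E.inner ξ ξ x).re :=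
  (Complex.re_eq_norm.2 (E.inner_nonneg' ξ x)).symm

theorem norm_le_iff (ξ : E.carrier) {K : ℝ} (hK : 0 ≤ K) :
    ‖ξ‖ ≤ K ↔ ∀ x, (E.inner ξ ξ x).re ≤ K ^ 2 := by
  rw [norm_def, Real.sqrt_le_left hK, ContinuousMap.norm_le _ (sq_nonneg K)]
  simp only [norm_inner_self]

theorem re_inner_le (ξ : E.carrier) (x : X) : (E.inner ξ ξ x).re ≤ ‖ξ‖ ^ 2 :=
  (E.norm_le_iff ξ (E.norm_nonneg' ξ)).1 le_rfl x

theorem norm_add_le' (ξ η : E.carrier) : ‖ξ + η‖ ≤ ‖ξ‖ + ‖η‖ := by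
  rw [norm_le_iff _ _ (add_nonneg (E.norm_nonneg' _) (E.norm_nonneg' _))]
  intro x
  have hcs : ‖E.inner ξ η x‖ * ‖E.inner η ξ x‖ ≤ (E.inner ξ ξ x).re * (E.inner η η x).re :=
    letI := E.evalCore x
    InnerProductSpace.Core.inner_mul_inner_self_le (𝕜 := ℂ) ξ η
  have hs : ∀ z, E.inner η ξ z = star (E.inner ξ η z) := by
    intro z; rw [← E.star_inner ξ η]; rfl
  rw [hs, norm_star] at hcs
  have h1 := E.re_inner_le ξ x
  have h2 := E.re_inner_le η x
  have h0 := E.re_nonneg ξ x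
  have h0' := E.re_nonneg η x
  have h3 : ‖E.inner ξ η x‖ ≤ ‖ξ‖ * ‖η‖ := by
    apply abs_le_of_sq_le_sq' _ (mul_nonneg (E.norm_nonneg' _) (E.norm_nonneg' _)) |>.2
    calc ‖E.inner ξ η x‖ ^ 2 ≤ _ := by rw [sq]; exact hcs
      _ ≤ ‖ξ‖ ^ 2 * ‖η‖ ^ 2 := mul_le_mul h1 h2 h0' (sq_nonneg _)
      _ = _ := by ring
  have h4 := Complex.re_le_norm (E.inner ξ η x)
  have : (E.inner (ξ + η) (ξ + η) x).re
      = (E.inner ξ ξ x).re + (E.inner η η x).re + 2 * (E.inner ξ η x).re := by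
    simp [hs]; ring
  rw [this]; nlinarith

/-- The seminorm of a correspondence. -/
noncomputable def groupSeminorm : AddGroupSeminorm E.carrier where
  toFun ξ := ‖ξ‖
  map_zero' := by simp [norm_def]
  add_le' := E.norm_add_le'
  neg' ξ := by simp [norm_def]

noncomputable instance : SeminormedAddCommGroup E.carrier :=
  { E.groupSeminorm.toSeminormedAddCommGroup with
    toNorm := E.instNorm
    dist_eq := fun ξ η => E.groupSeminorm.toSeminormedAddCommGroup.dist_eq ξ η }

noncomputable instance : NormedSpace ℂ E.carrier where
  norm_smul_le c ξ := by
    change √‖E.inner (c • ξ) (c • ξ)‖ ≤ ‖c‖ * √‖E.inner ξ ξ‖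
    simp only [map_smul, map_smulₛₗ, LinearMap.smul_apply, norm_smul, ← mul_assoc]
    rw [Real.sqrt_mul (by positivity)]
    simp
   


theorem norm_le_iff' (ξ : E.carrier) {K : ℝ} (hK : 0 ≤ K) :
    ‖ξ‖ ≤ K ↔ E.inner ξ ξ ≤ ((K ^ 2 : ℝ) : ℂ) • 1 := by
  rw [norm_le_iff _ _ hK, ContinuousMap.le_def]
  refine forall_congr' fun x => ?_
  rw [Complex.le_def]
  have := (Complex.nonneg_iff.mp (E.inner_nonneg' ξ x)).2
  simp [← this, -Complex.ofReal_pow]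

end Norm

/-- `C(X)` as a correspondence over itself, with `⟨a, b⟩ = a* b`. -/
noncomputable def regular (X : Type u) [TopologicalSpace X] [CompactSpace X] : PreCorr X where
  carrier := C(X, ℂ)
  left := Algebra.lmul ℂ C(X, ℂ)
  right := Algebra.lmul ℂ C(X, ℂ)
  inner := LinearMap.mk₂'ₛₗ (starRingEnd ℂ) (RingHom.id ℂ) (fun a b => star a * b)
    (by intros; simp [add_mul]) (by intros; ext; simp)
    (by intros; simp [mul_add]) (by intros; ext; simp)
  left_right a b ξ := mul_left_comm _ _ _
  inner_right ξ η a := by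
    simp only [LinearMap.mk₂'ₛₗ_apply, Algebra.lmul, AlgHom.coe_mk]
    exact (congrArg (star ξ * ·) (mul_comm a η)).trans (mul_assoc _ _ _).symm
  inner_left a ξ η := by simp [mul_assoc, mul_comm]
  star_inner ξ η := by simp [mul_comm]
  inner_nonneg ξ := star_mul_self_nonneg ξ

section Tensor

theorem sum_inner_left (F : PreCorr X) {n : ℕ} (a b : Fin n → Fin n → C(X, ℂ))
    (hab : ∀ i j, a i j = ∑ k, star (b k i) * b k j) (y : Fin n → F.carrier) :
    ∑ i, ∑ j, F.inner (y i) (F.left (a i j) (y j)) =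
      ∑ k, F.inner (∑ i, F.left (b k i) (y i)) (∑ j, F.left (b k j) (y j)) := by
  simp only [hab, map_sum, LinearMap.sum_apply, F.inner_left, map_mul, Module.End.mul_apply]
  rw [Finset.sum_comm_cycle]
  refine Finset.sum_congr rfl fun k _ => ?_
  rw [Finset.sum_comm]

theorem gram_factor (E : PreCorr X) {n : ℕ} (x : Fin n → E.carrier) :
    ∃ b : Fin n → Fin n → C(X, ℂ), ∀ i j, E.inner (x i) (x j) = ∑ k, star (b k i) * b k j := by
  refine exists_factor _ (fun i j => E.star_inner _ _) fun c => ?_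
  have : ∑ i, ∑ j, star (c i) * E.inner (x i) (x j) * c j
      = E.inner (∑ i, E.right (c i) (x i)) (∑ i, E.right (c i) (x i)) := by
    simp only [map_sum, LinearMap.sum_apply, E.inner_right]
    rw [Finset.sum_comm]
    refine Finset.sum_congr rfl fun i _ => Finset.sum_congr rfl fun j _ => ?_
    rw [← E.star_inner _ (E.right _ _), E.inner_right, star_mul, E.star_inner]
  rw [this]
  exact E.inner_nonneg _

variable (E F : PreCorr X)

/-- The form with `⟨ξ ⊗ η, ξ' ⊗ η'⟩ = ⟨η, ⟨ξ, ξ'⟩ · η'⟩` on the algebraic tensor product. -/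
noncomputable def tensorInner :
    (E.carrier ⊗[ℂ] F.carrier) →ₗ⋆[ℂ] (E.carrier ⊗[ℂ] F.carrier) →ₗ[ℂ] C(X, ℂ) :=
  TensorProduct.lift <| LinearMap.mk₂'ₛₗ (starRingEnd ℂ) (starRingEnd ℂ)
    (fun ξ η => TensorProduct.lift <| LinearMap.mk₂ ℂ
      (fun ξ' η' => F.inner η (F.left (E.inner ξ ξ') η'))
      (by intros; simp) (by intros; simp) (by intros; simp) (by intros; simp))
    (by intros; ext; simp) (by intros; ext; simp) (by intros; ext; simp) (by intros; ext; simp)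

@[simp] theorem tensorInner_tmul (ξ ξ' : E.carrier) (η η' : F.carrier) :
    E.tensorInner F (ξ ⊗ₜ η) (ξ' ⊗ₜ η') = F.inner η (F.left (E.inner ξ ξ') η') := rfl

/-- The left action `a · (ξ ⊗ η) = (a · ξ) ⊗ η`. -/
noncomputable def tensorLeft : C(X, ℂ) →ₐ[ℂ] Module.End ℂ (E.carrier ⊗[ℂ] F.carrier) :=
  (Module.End.rTensorAlgHom ℂ E.carrier F.carrier).comp E.left

@[simp] theorem tensorLeft_tmul (a : C(X, ℂ)) (ξ : E.carrier) (η : F.carrier) :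
    E.tensorLeft F a (ξ ⊗ₜ η) = E.left a ξ ⊗ₜ η := rfl

/-- The right action `(ξ ⊗ η) · a = ξ ⊗ (η · a)`. -/
noncomputable def tensorRight : C(X, ℂ) →ₐ[ℂ] Module.End ℂ (E.carrier ⊗[ℂ] F.carrier) :=
  (Module.End.lTensorAlgHom ℂ F.carrier E.carrier).comp F.right

@[simp] theorem tensorRight_tmul (a : C(X, ℂ)) (ξ : E.carrier) (η : F.carrier) :
    E.tensorRight F a (ξ ⊗ₜ η) = ξ ⊗ₜ F.right a η := rfl

theorem tensorInner_sum {n : ℕ} (x : Fin n → E.carrier) (y : Fin n → F.carrier) :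
    E.tensorInner F (∑ i, x i ⊗ₜ y i) (∑ i, x i ⊗ₜ y i) =
      ∑ i, ∑ j, F.inner (y i) (F.left (E.inner (x i) (x j)) (y j)) := by
  simp only [map_sum, LinearMap.sum_apply, tensorInner_tmul]
  exact Finset.sum_comm

/-- The algebraic tensor product over `ℂ` with the internal tensor product form; its Hausdorff
completion is the internal tensor product of `E` and `F`. -/
noncomputable def tensor : PreCorr X where
  carrier := E.carrier ⊗[ℂ] F.carrier
  left := E.tensorLeft F
  right := E.tensorRight F
  inner := E.tensorInner F
  left_right a b t := by
    induction t with
    | zero => simp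
    | add s t hs ht => simp only [map_add, hs, ht]
    | tmul ξ η => simp
  inner_right s t a := by
    induction s with
    | zero => simp
    | add s s' hs hs' => simp only [map_add, LinearMap.add_apply, hs, hs', add_mul]
    | tmul ξ η =>
      induction t with
      | zero => simp
      | add s s' hs hs' => simp only [map_add, hs, hs', add_mul]
      | tmul ξ' η' => simp [F.left_right, F.inner_right]
  inner_left a s t := by
    induction s with
    | zero => simp
    | add s s' hs hs' => simp only [map_add, LinearMap.add_apply, hs, hs']
    | tmul ξ η =>
      induction t with
      | zero => simp
      | add s s' hs hs' => simp only [map_add, hs, hs']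
      | tmul ξ' η' => simp [E.inner_left]
  star_inner s t := by
    induction s with
    | zero => simp
    | add s s' hs hs' => simp only [map_add, LinearMap.add_apply, hs, hs', star_add]
    | tmul ξ η =>
      induction t with
      | zero => simp
      | add s s' hs hs' => simp only [map_add, LinearMap.add_apply, hs, hs', star_add]
      | tmul ξ' η' => simp [F.star_inner, F.inner_left, E.star_inner]
  inner_nonneg t := by
    obtain ⟨n, x, y, rfl⟩ := TensorProduct.exists_sum_tmul_eq t
    obtain ⟨b, hb⟩ := E.gram_factor x
    rw [tensorInner_sum, F.sum_inner_left _ b hb]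
    exact Finset.sum_nonneg fun k _ => F.inner_nonneg _

/-- The `n`-fold algebraic internal tensor power `E ⊗ (E ⊗ (⋯ ⊗ E))`, with `C(X)` for `n = 0`. -/
noncomputable def tensorPow (E : PreCorr X) : ℕ → PreCorr X
  | 0 => regular X
  | 1 => E
  | n + 2 => E.tensor (tensorPow E (n + 1))

/-- The internal tensor power `E^{⊗n}`: the Hausdorff completion of the algebraic one. -/
abbrev Power (E : PreCorr X) (n : ℕ) : Type u :=
  UniformSpace.Completion (E.tensorPow n).carrier

end Tensor
end PreCorr

/-! ### Correspondence maps and their tensor powers -/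

/-- A `ρ`-correspondence map: a bounded linear map with `V(a ξ b) = ρ(a) V(ξ) ρ(b)`. -/
structure CorrMap {X : Type u} {Y : Type v} [TopologicalSpace X] [CompactSpace X]
    [TopologicalSpace Y] [CompactSpace Y] (ρ : C(X, ℂ) ≃⋆ₐ[ℂ] C(Y, ℂ))
    (E : PreCorr X) (F : PreCorr Y) where
  toLinearMap : E.carrier →ₗ[ℂ] F.carrier
  map_left : ∀ a ξ, toLinearMap (E.left a ξ) = F.left (ρ a) (toLinearMap ξ)
  map_right : ∀ a ξ, toLinearMap (E.right a ξ) = F.right (ρ a) (toLinearMap ξ)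
  bounded : ∃ K : ℝ, ∀ ξ, ‖toLinearMap ξ‖ ≤ K * ‖ξ‖

namespace CorrMap

variable {X : Type u} {Y : Type v} [TopologicalSpace X] [CompactSpace X]
    [TopologicalSpace Y] [CompactSpace Y] {ρ : C(X, ℂ) ≃⋆ₐ[ℂ] C(Y, ℂ)}
    {E E' : PreCorr X} {F F' : PreCorr Y}

theorem rho_nonneg {a : C(X, ℂ)} (ha : 0 ≤ a) : 0 ≤ ρ a := by
  obtain ⟨s, rfl⟩ := CStarAlgebra.nonneg_iff_eq_star_mul_self.mp ha
  rw [map_mul, map_star]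
  exact star_mul_self_nonneg _

theorem rho_mono {a b : C(X, ℂ)} (hab : a ≤ b) : ρ a ≤ ρ b := by
  rw [← sub_nonneg, ← map_sub]
  exact rho_nonneg (sub_nonneg.2 hab)

theorem bounded_of_dominated (V : E.carrier →ₗ[ℂ] F.carrier) {K : ℝ} (hK : 0 ≤ K)
    (h : ∀ ξ, F.inner (V ξ) (V ξ) ≤ ((K ^ 2 : ℝ) : ℂ) • ρ (E.inner ξ ξ)) (ξ : E.carrier) :
    ‖V ξ‖ ≤ K * ‖ξ‖ := by
  rw [F.norm_le_iff' _ (mul_nonneg hK (E.norm_nonneg' _))]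
  refine (h ξ).trans ?_
  have h1 := rho_mono (ρ := ρ) ((E.norm_le_iff' ξ (E.norm_nonneg' _)).1 le_rfl)
  rw [map_smul, map_one] at h1
  have h2 : (0 : ℂ) ≤ ((K ^ 2 : ℝ) : ℂ) := by exact_mod_cast sq_nonneg K
  calc _ ≤ ((K ^ 2 : ℝ) : ℂ) • (((‖ξ‖ ^ 2 : ℝ) : ℂ) • (1 : C(Y, ℂ))) := by
        intro y; exact mul_le_mul_of_nonneg_left (h1 y) h2
    _ = _ := by rw [smul_smul, mul_pow]; push_cast; rfl

/-- A bounded `ρ`-correspondence map satisfies `⟨V ξ, V ξ⟩ ≤ K² ρ(⟨ξ, ξ⟩)`. -/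
theorem dominated (V : CorrMap ρ E F) : ∃ K : ℝ, 0 ≤ K ∧
    ∀ ξ, F.inner (V.toLinearMap ξ) (V.toLinearMap ξ) ≤ ((K ^ 2 : ℝ) : ℂ) • ρ (E.inner ξ ξ) := by
  obtain ⟨K₀, hK₀⟩ := V.bounded
  obtain ⟨K, hK, hV⟩ : ∃ K : ℝ, 0 ≤ K ∧ ∀ ξ, ‖V.toLinearMap ξ‖ ≤ K * ‖ξ‖ :=
    ⟨|K₀|, abs_nonneg _, fun ξ => (hK₀ ξ).trans
      (mul_le_mul_of_nonneg_right (le_abs_self _) (E.norm_nonneg' _))⟩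
  refine ⟨K, hK, fun ξ => ?_⟩
  set p := E.inner ξ ξ with hp
  set q := F.inner (V.toLinearMap ξ) (V.toLinearMap ξ) with hq
  have key : ∀ ε : ℝ, 0 < ε → q ≤ ((K ^ 2 : ℝ) : ℂ) • (ρ p + (ε : ℂ) • 1) := by
    intro ε hε
    have hpos : ∀ x, 0 < (p x).re + ε := fun x => add_pos_of_nonneg_of_pos (E.re_nonneg ξ x) hε
    have hsc : Continuous fun x => √((p x).re + ε) := by fun_prop
    let s : C(X, ℂ) := ⟨fun x => (√((p x).re + ε) : ℝ), by fun_prop⟩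
    let a : C(X, ℂ) := ⟨fun x => ((√((p x).re + ε))⁻¹ : ℝ), Complex.continuous_ofReal.comp
      (hsc.inv₀ fun x => (Real.sqrt_pos.2 (hpos x)).ne')⟩
    have hpre : ∀ x, (((p x).re : ℝ) : ℂ) = p x := fun x => by
      have := (Complex.nonneg_iff.mp (E.inner_nonneg' ξ x)).2
      exact Complex.ext rfl this
    have hss : star s * s = p + (ε : ℂ) • 1 := by
      ext x
      have : (√((p x).re + ε) : ℂ) * (√((p x).re + ε) : ℂ) = p x + ε := by
        rw [← Complex.ofReal_mul, Real.mul_self_sqrt (hpos x).le]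
        push_cast; rw [hpre]
      simpa [s] using this
    have has : a * s = 1 := by
      ext x
      simp only [a, s, ContinuousMap.mul_apply, ContinuousMap.coe_mk, ContinuousMap.one_apply]
      rw [← Complex.ofReal_mul, inv_mul_cancel₀ (Real.sqrt_pos.2 (hpos x)).ne', Complex.ofReal_one]
    have hn : ‖E.right a ξ‖ ≤ 1 := by
      rw [E.norm_le_iff _ zero_le_one]
      intro x
      have h1 : E.inner (E.right a ξ) (E.right a ξ) = star a * p * a := by
        rw [E.inner_right, ← E.star_inner ξ (E.right a ξ), E.inner_right, star_mul, E.star_inner]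
      rw [h1]
      have h2 : (star a * p * a) x = (((√((p x).re + ε))⁻¹ * (p x).re * (√((p x).re + ε))⁻¹ : ℝ) : ℂ) := by
        push_cast
        rw [hpre]
        simp [a]
      rw [h2, Complex.ofReal_re]
      have h3 : (√((p x).re + ε))⁻¹ * (p x).re * (√((p x).re + ε))⁻¹ = (p x).re / ((p x).re + ε) := by
        rw [mul_right_comm, ← mul_inv, Real.mul_self_sqrt (hpos x).le]; ring
      rw [h3, one_pow, div_le_one (hpos x)]
      linarith
    have h4 : ‖V.toLinearMap (E.right a ξ)‖ ≤ K :=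
      (hV _).trans (by simpa using mul_le_mul_of_nonneg_left hn hK)
    rw [F.norm_le_iff' _ hK, V.map_right] at h4
    have h5 : F.inner (F.right (ρ a) (V.toLinearMap ξ)) (F.right (ρ a) (V.toLinearMap ξ))
        = star (ρ a) * q * ρ a := by
      rw [F.inner_right, ← F.star_inner _ (F.right (ρ a) _), F.inner_right, star_mul, F.star_inner]
    rw [h5] at h4
    have h6 := star_left_conjugate_le_conjugate h4 (ρ s)
    have h7 : star (ρ s) * (star (ρ a) * q * ρ a) * ρ s = q := by
      have e1 : ρ a * ρ s = 1 := by rw [← map_mul, has, map_one]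
      have e2 : star (ρ s) * star (ρ a) = 1 := by rw [← star_mul, e1, star_one]
      calc _ = (star (ρ s) * star (ρ a)) * q * (ρ a * ρ s) := by ring
        _ = q := by rw [e1, e2]; ring
    rw [h7] at h6
    refine h6.trans_eq ?_
    rw [mul_smul_comm, mul_one, smul_mul_assoc, ← map_star, ← map_mul, hss, map_add, map_smul,
      map_one]
  intro y
  have hq0 := Complex.nonneg_iff.mp (F.inner_nonneg' (V.toLinearMap ξ) y)
  have hp0 : (0 : ℂ) ≤ ρ p y := rho_nonneg (E.inner_nonneg ξ) y
  have hp0' := Complex.nonneg_iff.mp hp0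
  have hre : (q y).re ≤ K ^ 2 * (ρ p y).re := by
    refine le_of_forall_pos_le_add fun δ hδ => ?_
    have h1 : (q y).re ≤ ((((K ^ 2 : ℝ) : ℂ) •
        (ρ p + ((δ / (K ^ 2 + 1) : ℝ) : ℂ) • (1 : C(Y, ℂ)))) y).re :=
      (Complex.le_def.1 (key (δ / (K ^ 2 + 1)) (by positivity) y)).1
    have h2 : ((((K ^ 2 : ℝ) : ℂ) • (ρ p + ((δ / (K ^ 2 + 1) : ℝ) : ℂ) • (1 : C(Y, ℂ)))) y).re
        = K ^ 2 * ((ρ p y).re + δ / (K ^ 2 + 1)) := by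
      simp only [ContinuousMap.smul_apply, ContinuousMap.add_apply, ContinuousMap.one_apply,
        smul_eq_mul, Complex.re_ofReal_mul, Complex.add_re, mul_one, Complex.ofReal_re]
    rw [h2] at h1
    have h3 : K ^ 2 * (δ / (K ^ 2 + 1)) ≤ δ := by
      rw [← mul_div_assoc, div_le_iff₀ (by positivity)]; nlinarith
    linarith
  change q y ≤ (((K ^ 2 : ℝ) : ℂ) • ρ p) y
  rw [Complex.le_def]
  refine ⟨?_, ?_⟩
  · simpa only [ContinuousMap.smul_apply, smul_eq_mul, Complex.re_ofReal_mul] using hre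
  · simp only [ContinuousMap.smul_apply, smul_eq_mul, Complex.im_ofReal_mul]
    rw [← hp0'.2, mul_zero]; exact hq0.2.symm

/-- The map `ξ ⊗ η ↦ V ξ ⊗ W η` on algebraic tensor products; it is bounded. -/
noncomputable def tensor (V : CorrMap ρ E F) (W : CorrMap ρ E' F') :
    CorrMap ρ (E.tensor E') (F.tensor F') where
  toLinearMap := TensorProduct.map V.toLinearMap W.toLinearMap
  map_left a t := by
    change TensorProduct.map _ _ (E.tensorLeft E' a t) = F.tensorLeft F' (ρ a) (TensorProduct.map _ _ t)
    induction t using TensorProduct.induction_on with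
    | zero => simp
    | add s t hs ht => simp only [map_add, hs, ht]
    | tmul ξ η => simp [V.map_left]
  map_right a t := by
    change TensorProduct.map _ _ (E.tensorRight E' a t) = F.tensorRight F' (ρ a) (TensorProduct.map _ _ t)
    induction t using TensorProduct.induction_on with
    | zero => simp
    | add s t hs ht => simp only [map_add, hs, ht]
    | tmul ξ η => simp [W.map_right]
  bounded := by
    obtain ⟨K, hK, hV⟩ := V.dominated
    obtain ⟨M, hM, hW⟩ := W.dominated
    refine ⟨K * M, bounded_of_dominated (ρ := ρ) _ (mul_nonneg hK hM) fun t => ?_⟩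
    change F.tensorInner F' (TensorProduct.map V.toLinearMap W.toLinearMap t)
      (TensorProduct.map V.toLinearMap W.toLinearMap t) ≤ _ • ρ (E.tensorInner E' t t)
    obtain ⟨n, x, y, rfl⟩ := TensorProduct.exists_sum_tmul_eq t
    obtain ⟨b, hb⟩ := E.gram_factor x
    let κ : ℂ := ((K ^ 2 : ℝ) : ℂ)
    let D : Fin n → Fin n → C(Y, ℂ) := fun i j =>
      κ • ρ (E.inner (x i) (x j)) - F.inner (V.toLinearMap (x i)) (V.toLinearMap (x j))
    have hκ : star κ = κ := Complex.conj_ofReal _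
    obtain ⟨e, he⟩ : ∃ e : Fin n → Fin n → C(Y, ℂ), ∀ i j, D i j = ∑ k, star (e k i) * e k j := by
      refine PreCorr.exists_factor _ (fun i j => ?_) fun c => ?_
      · simp only [D, star_sub, star_smul, F.star_inner, ← map_star, E.star_inner, hκ]
      · obtain ⟨d, hd⟩ : ∃ d : Fin n → C(X, ℂ), ∀ i, ρ (d i) = c i :=
          ⟨fun i => ρ.symm (c i), fun i => ρ.apply_symm_apply _⟩
        have h := hV (∑ i, E.right (d i) (x i))
        rw [← sub_nonneg] at h
        convert h using 1
        simp only [map_sum, LinearMap.sum_apply, E.inner_right, F.inner_right, V.map_right, hd,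
          Finset.smul_sum, ← Finset.sum_sub_distrib]
        rw [Finset.sum_comm]
        refine Finset.sum_congr rfl fun i _ => Finset.sum_congr rfl fun j _ => ?_
        rw [← E.star_inner _ (E.right _ _), ← F.star_inner _ (F.right _ _), E.inner_right,
          F.inner_right, star_mul, star_mul, E.star_inner, F.star_inner]
        simp only [map_mul, map_star, hd, D, mul_sub, sub_mul, mul_smul_comm, smul_mul_assoc, κ]
    have hsum : F.tensorInner F' (TensorProduct.map V.toLinearMap W.toLinearMap (∑ i, x i ⊗ₜ y i))
        (TensorProduct.map V.toLinearMap W.toLinearMap (∑ i, x i ⊗ₜ y i)) =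
        κ • ∑ i, ∑ j, F'.inner (W.toLinearMap (y i))
            (F'.left (ρ (E.inner (x i) (x j))) (W.toLinearMap (y j))) -
          ∑ i, ∑ j, F'.inner (W.toLinearMap (y i)) (F'.left (D i j) (W.toLinearMap (y j))) := by
      rw [map_sum]
      simp only [TensorProduct.map_tmul]
      rw [PreCorr.tensorInner_sum, Finset.smul_sum, ← Finset.sum_sub_distrib]
      refine Finset.sum_congr rfl fun i _ => ?_
      rw [Finset.smul_sum, ← Finset.sum_sub_distrib]
      refine Finset.sum_congr rfl fun j _ => ?_
      simp [D]
    have hfac : ∀ i j, ρ (E.inner (x i) (x j)) = ∑ k, star (ρ (b k i)) * ρ (b k j) := by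
      intro i j
      simp only [hb, map_sum, map_mul, map_star]
    rw [hsum, F'.sum_inner_left _ e he, F'.sum_inner_left _ (fun k i => ρ (b k i)) hfac,
      PreCorr.tensorInner_sum, E'.sum_inner_left _ b hb]
    refine (sub_le_self _ (Finset.sum_nonneg fun k _ => F'.inner_nonneg _)).trans ?_
    simp only [← W.map_left, ← map_sum W.toLinearMap]
    have h8 : ∑ k, F'.inner (W.toLinearMap (∑ i, E'.left (b k i) (y i)))
        (W.toLinearMap (∑ i, E'.left (b k i) (y i))) ≤ ((M ^ 2 : ℝ) : ℂ) •
          ρ (∑ k, E'.inner (∑ i, E'.left (b k i) (y i)) (∑ i, E'.left (b k i) (y i))) := by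
      rw [map_sum ρ, Finset.smul_sum]
      exact Finset.sum_le_sum fun k _ => hW _
    have h9 : (0 : ℂ) ≤ κ := by simp only [κ]; exact_mod_cast sq_nonneg K
    have h10 : (((K * M) ^ 2 : ℝ) : ℂ) = κ * ((M ^ 2 : ℝ) : ℂ) := by
      simp only [κ]; push_cast; ring
    rw [h10, mul_smul]
    exact fun z => mul_le_mul_of_nonneg_left (h8 z) h9

/-- `ρ` itself, as a `ρ`-correspondence map from `C(X)` to `C(Y)`. -/
noncomputable def regular (ρ : C(X, ℂ) ≃⋆ₐ[ℂ] C(Y, ℂ)) :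
    CorrMap ρ (PreCorr.regular X) (PreCorr.regular Y) where
  toLinearMap := (ρ.toAlgEquiv.toLinearMap : C(X, ℂ) →ₗ[ℂ] C(Y, ℂ))
  map_left a ξ := map_mul ρ a ξ
  map_right a ξ := map_mul ρ a ξ
  bounded := ⟨1, bounded_of_dominated (ρ := ρ) _ zero_le_one fun (ξ : C(X, ℂ)) => by
    change star (ρ ξ) * ρ ξ ≤ _ • ρ (star ξ * ξ)
    rw [map_mul, map_star]; simp⟩

/-- The map `ξ_n ⊗ ⋯ ⊗ ξ_1 ↦ V ξ_n ⊗ ⋯ ⊗ V ξ_1` on algebraic tensor powers (`ρ` for `n = 0`). -/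
noncomputable def tensorPow (V : CorrMap ρ E F) : ∀ n : ℕ, CorrMap ρ (E.tensorPow n) (F.tensorPow n)
  | 0 => regular ρ
  | 1 => V
  | n + 2 => V.tensor (tensorPow V (n + 1))

/-- A correspondence map as a continuous linear map. -/
noncomputable def toCLM (V : CorrMap ρ E F) : E.carrier →L[ℂ] F.carrier :=
  V.toLinearMap.mkContinuousOfExistsBound V.bounded

/-- The bounded operator `V^{⊗n} : E^{⊗n} → F^{⊗n}`, the continuous extension to the completions
of `ξ_n ⊗ ⋯ ⊗ ξ_1 ↦ V ξ_n ⊗ ⋯ ⊗ V ξ_1`. -/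
noncomputable def power (V : CorrMap ρ E F) (n : ℕ) : E.Power n →L[ℂ] F.Power n :=
  (V.tensorPow n).toCLM.completion

/-- `sup_n ‖V^{⊗n}‖ < ∞`. -/
def TensorPowerBounded (V : CorrMap ρ E F) : Prop :=
  ∃ K : ℝ, ∀ n, ‖V.power n‖ ≤ K

end CorrMap

/-- A `ρ`-similarity: a bijective `ρ`-correspondence map `V`, bundled with its inverse, such that
`V` and `V⁻¹` are tensor-power bounded. -/
structure Similarity {X : Type u} {Y : Type v} [TopologicalSpace X] [CompactSpace X]
    [TopologicalSpace Y] [CompactSpace Y] (ρ : C(X, ℂ) ≃⋆ₐ[ℂ] C(Y, ℂ))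
    (E : PreCorr X) (F : PreCorr Y) where
  map : CorrMap ρ E F
  inv : CorrMap ρ.symm F E
  left_inv : ∀ ξ, inv.toLinearMap (map.toLinearMap ξ) = ξ
  right_inv : ∀ η, map.toLinearMap (inv.toLinearMap η) = η
  map_powerBounded : map.TensorPowerBounded
  inv_powerBounded : inv.TensorPowerBounded

/-- `sup_n max {‖V^{⊗n}‖², ‖(V⁻¹)^{⊗n}‖²}` (a supremum of a bounded set of real numbers). -/
noncomputable def Similarity.const {X : Type u} {Y : Type v} [TopologicalSpace X] [CompactSpace X]
    [TopologicalSpace Y] [CompactSpace Y] {ρ : C(X, ℂ) ≃⋆ₐ[ℂ] C(Y, ℂ)}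
    {E : PreCorr X} {F : PreCorr Y} (S : Similarity ρ E F) : ℝ :=
  ⨆ n : ℕ, max (‖S.map.power n‖ ^ 2) (‖S.inv.power n‖ ^ 2)

/-! ### Weighted partial systems -/

/-- A `d`-variable weighted partial system on `X`: continuous maps `σ_i : X_i → X` and continuous
positive weights `w_i : X_i → (0, ∞)` on clopen sets `X_i`, for `i = 1, …, d`. -/
structure WPS (d : ℕ) (X : Type u) [TopologicalSpace X] where
  dom : Fin d → Set X
  isClopen_dom : ∀ i, IsClopen (dom i)
  map : ∀ i, C(dom i, X)
  weight : ∀ i, C(dom i, ℝ)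
  weight_pos : ∀ i x, 0 < weight i x

namespace WPS

section Basic

variable {d : ℕ} {X : Type u} {Y : Type v} [TopologicalSpace X] [TopologicalSpace Y]

/-- `Gr(σ)`, the set of all edges `(σ_i(x), x)` with `x ∈ X_i`. -/
def graph (σ : WPS d X) : Set (X × X) :=
  {e | ∃ (i : Fin d) (h : e.2 ∈ σ.dom i), σ.map i ⟨e.2, h⟩ = e.1}

open Classical in
/-- `w(e) = ∑ w_i(s(e))` over all `i` with `s(e) ∈ X_i` and `σ_i(s(e)) = r(e)`. -/
noncomputable def edgeWeight (σ : WPS d X) (e : X × X) : ℝ :=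
  ∑ i, if h : e.2 ∈ σ.dom i then (if σ.map i ⟨e.2, h⟩ = e.1 then σ.weight i ⟨e.2, h⟩ else 0) else 0

/-- `μ 0, …, μ (n - 1)` is a path `μ_n ⋯ μ_1`: the range of each edge is the source of the next. -/
def IsPath (σ : WPS d X) {n : ℕ} (μ : Fin n → σ.graph) : Prop :=
  ∀ (k : ℕ) (h : k + 1 < n),
    (μ ⟨k, Nat.lt_of_succ_lt h⟩ : X × X).1 = (μ ⟨k + 1, h⟩ : X × X).2

/-- `(τ^γ, u^γ)`: the maps `γ⁻¹ τ_i γ` and the weights `u_i γ`, on `γ⁻¹(Y_i)`. -/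
def pullback (τ : WPS d Y) (γ : X ≃ₜ Y) : WPS d X where
  dom i := γ ⁻¹' τ.dom i
  isClopen_dom i := (τ.isClopen_dom i).preimage γ.continuous
  map i := ⟨fun x => γ.symm (τ.map i ⟨γ x, x.2⟩), by fun_prop⟩
  weight i := ⟨fun x => τ.weight i ⟨γ x, x.2⟩, by fun_prop⟩
  weight_pos i x := τ.weight_pos i ⟨γ x, x.2⟩

/-- `(σ, w)` and `(τ, u)` are weighted-orbit conjugate via `γ` with constant `C ≥ 1`. -/
def WeightedOrbitConj {d' : ℕ} (σ : WPS d X) (τ : WPS d' Y) (γ : X ≃ₜ Y) (C : ℝ) : Prop :=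
  1 ≤ C ∧ σ.graph = (τ.pullback γ).graph ∧
    ∃ H : C(σ.graph, ℝ), ∀ (n : ℕ) (μ : Fin n → σ.graph), σ.IsPath μ →
      1 / C ≤ ∏ k, ((τ.pullback γ).edgeWeight (μ k) / σ.edgeWeight (μ k) * H (μ k)) ∧
      ∏ k, ((τ.pullback γ).edgeWeight (μ k) / σ.edgeWeight (μ k) * H (μ k)) ≤ C

/-- The edge `(σ_i(x), x)` for `x ∈ X_i`. -/
def edge (σ : WPS d X) (i : Fin d) : C(σ.dom i, σ.graph) where
  toFun x := ⟨(σ.map i x, x), i, x.2, rfl⟩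
  continuous_toFun := by fun_prop

/-- The range map `r(y, x) = y`. -/
def range (σ : WPS d X) : C(σ.graph, X) := ⟨fun e => e.1.1, by fun_prop⟩

/-- The source map `s(y, x) = x`. -/
def source (σ : WPS d X) : C(σ.graph, X) := ⟨fun e => e.1.2, by fun_prop⟩

open Classical in
/-- Extension by zero of a continuous function on a clopen set. -/
noncomputable def extendZero {s : Set X} (hs : IsClopen s) (g : C(s, ℂ)) : C(X, ℂ) where
  toFun x := if h : x ∈ s then g ⟨x, h⟩ else 0
  continuous_toFun := by
    rw [← continuousOn_univ, ← Set.union_compl_self s]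
    refine ContinuousOn.union_of_isOpen ?_ ?_ hs.isOpen hs.compl.isOpen
    · rw [continuousOn_iff_continuous_domRestrict]
      convert g.continuous using 1
      ext x; simp
    · refine (continuousOn_const (c := (0 : ℂ))).congr fun x hx => ?_
      exact dif_neg hx

end Basic

variable {d : ℕ} {X : Type u} [TopologicalSpace X] [CompactSpace X]

/-- `⟨ξ, η⟩_w(x) = ∑_{i : x ∈ X_i} conj(ξ(σ_i(x), x)) w_i(x) η(σ_i(x), x)`. -/
noncomputable def innerFun (σ : WPS d X) (ξ η : C(σ.graph, ℂ)) : C(X, ℂ) :=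
  ∑ i, extendZero (σ.isClopen_dom i)
    ⟨fun x => star (ξ (σ.edge i x)) * (σ.weight i x : ℂ) * η (σ.edge i x), by fun_prop⟩

open Classical in
theorem innerFun_apply (σ : WPS d X) (ξ η : C(σ.graph, ℂ)) (x : X) :
    σ.innerFun ξ η x = ∑ i, if h : x ∈ σ.dom i then
      star (ξ (σ.edge i ⟨x, h⟩)) * (σ.weight i ⟨x, h⟩ : ℂ) * η (σ.edge i ⟨x, h⟩) else 0 := by
  simp [innerFun, extendZero, ContinuousMap.sum_apply]

theorem innerFun_congr (σ : WPS d X) {ξ η ξ' η' : C(σ.graph, ℂ)} {c c' : C(X, ℂ)}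
    (h : ∀ e : σ.graph, star (ξ e) * η e * c e.1.2 = star (ξ' e) * η' e * c' e.1.2) :
    σ.innerFun ξ η * c = σ.innerFun ξ' η' * c' := by
  classical
  ext x
  simp only [ContinuousMap.mul_apply, innerFun_apply, Finset.sum_mul]
  refine Finset.sum_congr rfl fun i _ => ?_
  split_ifs with hx
  · have := h (σ.edge i ⟨x, hx⟩)
    simp only [edge, ContinuousMap.coe_mk] at this ⊢
    linear_combination (σ.weight i ⟨x, hx⟩ : ℂ) * this
  · simp

/-- The action `(a · ξ)(e) = a(p(e)) ξ(e)`. -/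
noncomputable def mulAction (σ : WPS d X) (p : C(σ.graph, X)) :
    C(X, ℂ) →ₐ[ℂ] Module.End ℂ C(σ.graph, ℂ) :=
  (Algebra.lmul ℂ C(σ.graph, ℂ)).comp (ContinuousMap.compStarAlgHom' ℂ ℂ p).toAlgHom

theorem mulAction_apply (σ : WPS d X) (p : C(σ.graph, X)) (a : C(X, ℂ)) (ξ : C(σ.graph, ℂ)) :
    σ.mulAction p a ξ = a.comp p * ξ := rfl

/-- The correspondence `C(σ, w)` over `C(X)`: the space `C(Gr(σ))` with
`(f · ξ · g)(e) = f(r(e)) ξ(e) g(s(e))` and the inner product `⟨ξ, η⟩_w`. Its norm is equivalent to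
the supremum norm, so it is complete. -/
noncomputable def corr (σ : WPS d X) : PreCorr X where
  carrier := C(σ.graph, ℂ)
  left := σ.mulAction σ.range
  right := σ.mulAction σ.source
  inner := LinearMap.mk₂'ₛₗ (starRingEnd ℂ) (RingHom.id ℂ) σ.innerFun
    (by
      intro ξ ξ' η; ext x
      simp only [innerFun_apply, ContinuousMap.add_apply, star_add, add_mul, ← Finset.sum_add_distrib]
      refine Finset.sum_congr rfl fun i _ => ?_
      split_ifs <;> simp)
    (by
      intro c ξ η; ext x
      simp only [innerFun_apply, ContinuousMap.smul_apply, Finset.smul_sum]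
      refine Finset.sum_congr rfl fun i _ => ?_
      split_ifs <;> simp [mul_assoc])
    (by
      intro ξ ξ' η; ext x
      simp only [innerFun_apply, ContinuousMap.add_apply, mul_add, ← Finset.sum_add_distrib]
      refine Finset.sum_congr rfl fun i _ => ?_
      split_ifs <;> simp)
    (by
      intro c ξ η; ext x
      simp only [innerFun_apply, ContinuousMap.smul_apply, Finset.smul_sum]
      refine Finset.sum_congr rfl fun i _ => ?_
      split_ifs <;> simp [mul_left_comm])
  left_right a b ξ := by
    simp only [mulAction_apply]; exact mul_left_comm _ _ _
  inner_right ξ η a := by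
    simp only [LinearMap.mk₂'ₛₗ_apply, mulAction_apply]
    rw [← mul_one (σ.innerFun ξ _)]
    refine σ.innerFun_congr fun e => ?_
    simp only [ContinuousMap.mul_apply, ContinuousMap.comp_apply, source, ContinuousMap.coe_mk, ContinuousMap.one_apply]
    ring
  inner_left a ξ η := by
    simp only [LinearMap.mk₂'ₛₗ_apply, mulAction_apply]
    rw [← mul_one (σ.innerFun _ η), ← mul_one (σ.innerFun ξ _)]
    refine σ.innerFun_congr fun e => ?_
    simp only [ContinuousMap.mul_apply, ContinuousMap.comp_apply, ContinuousMap.star_apply, star_mul]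
    ring
  star_inner ξ η := by
    ext x
    simp only [LinearMap.mk₂'ₛₗ_apply, ContinuousMap.star_apply, innerFun_apply, star_sum]
    refine Finset.sum_congr rfl fun i _ => ?_
    split_ifs
    · simp; ring
    · simp
  inner_nonneg ξ := by
    intro x
    change 0 ≤ σ.innerFun ξ ξ x
    rw [innerFun_apply]
    refine Finset.sum_nonneg fun i _ => ?_
    split_ifs with h
    · rw [mul_right_comm]
      exact mul_nonneg (star_mul_self_nonneg _) (by exact_mod_cast (σ.weight_pos i ⟨x, h⟩).le)
    · exact le_rfl

end WPS

/-! Evaluation along edges (`evalPath`) turns elements of the n-th tensor power, n ≥ 1, into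
functions on paths of length n. In this picture the inner product at x is a finite sum over the
paths starting at x, each weighted by the product of its edge weights (`inner_tensorPow_apply`).

Suppose V is a weighted composition operator ξ ↦ h · (ξ ∘ φ), with φ the edge map induced by γ⁻¹.
Then V^{⊗n} composes with φ along paths and multiplies by ∏ h(ν_k) (`evalPath_corrMap_tensorPow`).
Hence ‖V^{⊗n}‖² is the supremum over paths ν of ∏ u(ν_k)|h(ν_k)|² / w(φ(ν_k)): `WPS.norm_power_le`
bounds it above, and `prod_le_norm_power_sq` bounds it below by testing on an element that isolates
one path. The inverse has multiplier 1/h, so its norms control the reciprocal products. With H equal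
to |h|² carried over to Gr(σ), the bounds on V and V⁻¹ are exactly the upper and lower inequalities
of weighted-orbit conjugacy.

One direction therefore takes h = √H. For the other, every bimodule map has this form: multiplying
by bump functions on both sides shows that V is local (`evalEdge_corrMap_eq_zero`), so h = V(1)
serves as the multiplier, and surjectivity of V and of V⁻¹ forces the graphs to agree. The power n =
0 is separate: there V^{⊗0} = ρ has norm 1, which matches C ≥ 1. -/

theorem exists_continuous_bump {X : Type*} [TopologicalSpace X] [NormalSpace X] [T1Space X]
    {x : X} {U : Set X} (hU : IsOpen U) (hx : x ∈ U) :
    ∃ a : C(X, ℂ), a x = 1 ∧ (∀ z ∉ U, a z = 0) ∧ ∀ z, ‖a z‖ ≤ 1 := by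
  obtain ⟨f, h0, h1, h⟩ := exists_continuous_zero_one_of_isClosed hU.isClosed_compl
    (isClosed_singleton (x := x)) (by simpa using hx)
  refine ⟨⟨fun z => (f z : ℂ), by fun_prop⟩, ?_, fun z hz => ?_, fun z => ?_⟩
  · simp [h1 rfl]
  · simp [h0 hz]
  · simpa [abs_of_nonneg (h z).1] using (h z).2

/-! ### Elementary tensors in tensor powers -/

namespace PreCorr

variable {X : Type u} [TopologicalSpace X] [CompactSpace X] (E : PreCorr X)

/-- The elementary tensor `ξ ⊗ η` in the algebraic tensor power `E^{⊗(n+2)}`. -/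
noncomputable def tmulPow {n : ℕ} (ξ : E.carrier) (η : (E.tensorPow (n + 1)).carrier) :
    (E.tensorPow (n + 2)).carrier :=
  ξ ⊗ₜ[ℂ] η

theorem tensorPow_induction {n : ℕ} {p : (E.tensorPow (n + 2)).carrier → Prop} (zero : p 0)
    (tmul : ∀ ξ η, p (E.tmulPow ξ η)) (add : ∀ s t, p s → p t → p (s + t))
    (t : (E.tensorPow (n + 2)).carrier) : p t :=
  TensorProduct.induction_on (motive := p) t zero tmul add

theorem left_tmulPow {n : ℕ} (a : C(X, ℂ)) (ξ : E.carrier) (η : (E.tensorPow (n + 1)).carrier) :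
    (E.tensorPow (n + 2)).left a (E.tmulPow ξ η) = E.tmulPow (E.left a ξ) η := rfl

theorem inner_tmulPow {n : ℕ} (ξ ξ' : E.carrier) (η η' : (E.tensorPow (n + 1)).carrier) :
    (E.tensorPow (n + 2)).inner (E.tmulPow ξ η) (E.tmulPow ξ' η') =
      (E.tensorPow (n + 1)).inner η ((E.tensorPow (n + 1)).left (E.inner ξ ξ') η') := rfl

end PreCorr

/-! ### Norm bounds on algebraic tensor powers and at single points -/

namespace CorrMap

variable {X : Type u} {Y : Type v} [TopologicalSpace X] [CompactSpace X]
    [TopologicalSpace Y] [CompactSpace Y] {ρ : C(X, ℂ) ≃⋆ₐ[ℂ] C(Y, ℂ)}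
    {E : PreCorr X} {F : PreCorr Y}

theorem norm_tensorPow_le (V : CorrMap ρ E F) (n : ℕ) (t : (E.tensorPow n).carrier) :
    ‖(V.tensorPow n).toLinearMap t‖ ≤ ‖V.power n‖ * ‖t‖ := by
  have h := (V.power n).le_opNorm (t : E.Power n)
  rw [UniformSpace.Completion.norm_coe] at h
  refine le_trans (le_of_eq ?_) h
  rw [power, ContinuousLinearMap.completion_apply_coe, UniformSpace.Completion.norm_coe]
  rfl

theorem norm_power_le (V : CorrMap ρ E F) (n : ℕ) {K : ℝ} (hK : 0 ≤ K)
    (h : ∀ t, ‖(V.tensorPow n).toLinearMap t‖ ≤ K * ‖t‖) : ‖V.power n‖ ≤ K := by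
  refine ContinuousLinearMap.opNorm_le_bound _ hK fun t => ?_
  induction t using UniformSpace.Completion.induction_on with
  | hp => exact isClosed_le (by fun_prop) (by fun_prop)
  | ih t =>
    rw [power, ContinuousLinearMap.completion_apply_coe, UniformSpace.Completion.norm_coe,
      UniformSpace.Completion.norm_coe]
    exact h t

/-- A norm bound localises to each point with the same constant. Multiply ξ on the right by a bump a
at δ(y), supported where ⟨ξ, ξ⟩ exceeds its value at δ(y) by less than ε. The norm of ξ·a is then
governed by that value, while ρ(a)(y) = 1 leaves ⟨Vξ, Vξ⟩(y) unchanged. Keeping the constant is what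
later yields the sharp C. -/
theorem re_inner_le_of_norm_le [T2Space X] (V : CorrMap ρ E F) {δ : Y → X}
    (hδ : ∀ f y, ρ f y = f (δ y)) {K : ℝ} (hV : ∀ ξ, ‖V.toLinearMap ξ‖ ≤ K * ‖ξ‖)
    (hK : 0 ≤ K) (ξ : E.carrier) (y : Y) :
    (F.inner (V.toLinearMap ξ) (V.toLinearMap ξ) y).re ≤ K ^ 2 * (E.inner ξ ξ (δ y)).re := by
  have key : ∀ ε : ℝ, 0 < ε → (F.inner (V.toLinearMap ξ) (V.toLinearMap ξ) y).re
      ≤ K ^ 2 * ((E.inner ξ ξ (δ y)).re + ε) := by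
    intro ε hε
    have hp := E.re_nonneg ξ (δ y)
    obtain ⟨a, ha1, ha0, ha⟩ := exists_continuous_bump
      (U := {x | (E.inner ξ ξ x).re < (E.inner ξ ξ (δ y)).re + ε}) (x := δ y)
      (isOpen_lt (by fun_prop) (by fun_prop)) (by simpa using hε)
    have hE : ∀ x, (E.inner (E.right a ξ) (E.right a ξ) x).re
        = ‖a x‖ ^ 2 * (E.inner ξ ξ x).re := by
      intro x
      have h1 : E.inner (E.right a ξ) (E.right a ξ) = (star a * a) * E.inner ξ ξ := by
        rw [E.inner_right, ← E.star_inner ξ (E.right a ξ), E.inner_right, star_mul, E.star_inner]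
        ring
      rw [h1, ContinuousMap.mul_apply, ContinuousMap.mul_apply, ContinuousMap.star_apply,
        Complex.star_def, ← Complex.normSq_eq_conj_mul_self, Complex.re_ofReal_mul,
        Complex.normSq_eq_norm_sq]
    have h2 : F.inner (V.toLinearMap (E.right a ξ)) (V.toLinearMap (E.right a ξ)) y
        = F.inner (V.toLinearMap ξ) (V.toLinearMap ξ) y := by
      rw [V.map_right, F.inner_right, ← F.star_inner _ (F.right _ _), F.inner_right, star_mul,
        F.star_inner]
      simp [hδ, ha1]
    have h3 : ‖E.right a ξ‖ ≤ √((E.inner ξ ξ (δ y)).re + ε) := by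
      rw [E.norm_le_iff _ (Real.sqrt_nonneg _)]
      intro x
      rw [Real.sq_sqrt (by linarith), hE]
      by_cases hx : (E.inner ξ ξ x).re < (E.inner ξ ξ (δ y)).re + ε
      · have := pow_le_one₀ (n := 2) (norm_nonneg _) (ha x)
        nlinarith [E.re_nonneg ξ x]
      · rw [ha0 x hx]; simp; linarith
    have h4 := (hV (E.right a ξ)).trans (mul_le_mul_of_nonneg_left h3 hK)
    rw [F.norm_le_iff _ (by positivity)] at h4
    have h5 := h4 y
    rwa [h2, mul_pow, Real.sq_sqrt (by linarith)] at h5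
  refine le_of_forall_pos_le_add fun ε hε => ?_
  -- Dividing by K² + 1 instead of K² covers K = 0.
  have h1 := key (ε / (K ^ 2 + 1)) (by positivity)
  have h3 : K ^ 2 * (ε / (K ^ 2 + 1)) ≤ ε := by
    rw [← mul_div_assoc, div_le_iff₀ (by positivity)]; nlinarith
  linarith

end CorrMap

/-! ### Paths, edge weights and compactness of the graph -/

namespace WPS

section Paths

variable {d : ℕ} {X : Type u} [TopologicalSpace X]

theorem finite_setOf_source_eq (σ : WPS d X) (x : X) : {e : σ.graph | σ.source e = x}.Finite := by
  classical
  refine Set.Finite.subset (Set.finite_range (fun i : {i : Fin d // x ∈ σ.dom i} =>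
    σ.edge i.1 ⟨x, i.2⟩)) ?_
  rintro ⟨⟨y, z⟩, i, hi, h⟩ (rfl : z = x)
  exact ⟨⟨i, hi⟩, Subtype.ext (Prod.ext h rfl)⟩

/-- The finite set of edges with source `x`. -/
noncomputable def out (σ : WPS d X) (x : X) : Finset σ.graph := (σ.finite_setOf_source_eq x).toFinset

@[simp] theorem mem_out (σ : WPS d X) (x : X) (e : σ.graph) : e ∈ σ.out x ↔ σ.source e = x := by
  simp [out]

/-- The finite set of paths of length `n + 1` that start at `x`. -/
noncomputable def paths (σ : WPS d X) : ∀ n : ℕ, X → Finset (Fin (n + 1) → σ.graph)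
  | 0, x => (σ.out x).map ⟨fun e _ => e, fun _ _ h => congrFun h 0⟩
  | n + 1, x => ((σ.paths n x).sigma fun μ => σ.out (σ.range (μ (Fin.last n)))).map
      ⟨fun p => Fin.snoc (α := fun _ => σ.graph) p.1 p.2, by
        rintro ⟨μ, e⟩ ⟨ν, f⟩ h
        have h' := Fin.snoc_injective2 h
        obtain ⟨rfl, rfl⟩ : μ = ν ∧ e = f := h'
        rfl⟩

theorem sum_paths_zero (σ : WPS d X) (x : X) {M : Type*} [AddCommMonoid M]
    (f : (Fin 1 → σ.graph) → M) : ∑ μ ∈ σ.paths 0 x, f μ = ∑ e ∈ σ.out x, f fun _ => e := by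
  rw [paths, Finset.sum_map]; rfl

theorem sum_paths_succ (σ : WPS d X) (n : ℕ) (x : X) {M : Type*} [AddCommMonoid M]
    (f : (Fin (n + 2) → σ.graph) → M) :
    ∑ μ ∈ σ.paths (n + 1) x, f μ = ∑ μ ∈ σ.paths n x, ∑ e ∈ σ.out (σ.range (μ (Fin.last n))),
      f (Fin.snoc (α := fun _ => σ.graph) μ e) := by
  rw [paths, Finset.sum_map, Finset.sum_sigma]; rfl

theorem mem_paths_succ (σ : WPS d X) (n : ℕ) (x : X) (μ : Fin (n + 2) → σ.graph) :
    μ ∈ σ.paths (n + 1) x ↔ (Fin.init μ : Fin (n + 1) → σ.graph) ∈ σ.paths n x ∧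
      σ.source (μ (Fin.last (n + 1))) = σ.range (μ (Fin.last n).castSucc) := by
  simp only [paths, Finset.mem_map, Finset.mem_sigma, mem_out]
  constructor
  · rintro ⟨⟨ν, e⟩, ⟨h1, h2⟩, h⟩
    obtain rfl : Fin.snoc (α := fun _ => σ.graph) ν e = μ := h
    simpa using ⟨h1, h2⟩
  · rintro ⟨h1, h2⟩
    exact ⟨⟨Fin.init μ, μ (Fin.last _)⟩, ⟨h1, h2⟩, Fin.snoc_init_self μ⟩

theorem isPath_succ (σ : WPS d X) (n : ℕ) (μ : Fin (n + 2) → σ.graph) :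
    σ.IsPath μ ↔ σ.IsPath (Fin.init μ : Fin (n + 1) → σ.graph) ∧
      σ.source (μ (Fin.last (n + 1))) = σ.range (μ (Fin.last n).castSucc) := by
  constructor
  · exact fun h => ⟨fun k hk => h k (by omega), (h n (by omega)).symm⟩
  · rintro ⟨h1, h2⟩ k hk
    rcases Nat.lt_or_ge (k + 1) (n + 1) with h | h
    · exact h1 k h
    · obtain rfl : k = n := by omega
      exact h2.symm

/-- The recursion in `paths` is what inductions on tensor powers use, whereas orbit conjugacy is
phrased with `IsPath`; this links the two. The index is shifted: `paths n` consists of tuples of n +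
1 edges, so the empty path never occurs. -/
theorem mem_paths (σ : WPS d X) (n : ℕ) (x : X) (μ : Fin (n + 1) → σ.graph) :
    μ ∈ σ.paths n x ↔ σ.IsPath μ ∧ σ.source (μ 0) = x := by
  induction n with
  | zero =>
    have h : σ.IsPath μ := fun k hk => by omega
    simp only [paths, Finset.mem_map, mem_out, h, true_and]
    constructor
    · rintro ⟨e, he, rfl⟩; exact he
    · exact fun h => ⟨μ 0, h, funext fun i => congrArg μ (Subsingleton.elim (α := Fin 1) 0 i)⟩
  | succ n ih =>
    rw [mem_paths_succ, isPath_succ, ih]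
    simp only [Fin.init, Fin.castSucc_zero]
    tauto

theorem edgeWeight_nonneg (σ : WPS d X) (e : X × X) : 0 ≤ σ.edgeWeight e := by
  refine Finset.sum_nonneg fun i _ => ?_
  split_ifs
  · exact (σ.weight_pos _ _).le
  all_goals exact le_rfl

theorem edgeWeight_pos (σ : WPS d X) (e : σ.graph) : 0 < σ.edgeWeight e := by
  obtain ⟨e, i, hi, h⟩ := e
  refine Finset.sum_pos' (fun i _ => ?_) ⟨i, Finset.mem_univ i, ?_⟩
  · split_ifs
    · exact (σ.weight_pos _ _).le
    all_goals exact le_rfl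
  · rw [dif_pos hi, if_pos h]
    exact σ.weight_pos _ _

theorem edgeWeight_pullback {Y : Type v} [TopologicalSpace Y] (τ : WPS d Y) (γ : X ≃ₜ Y)
    (e : X × X) : (τ.pullback γ).edgeWeight e = τ.edgeWeight (γ e.1, γ e.2) := by
  classical
  refine Finset.sum_congr rfl fun i _ => ?_
  change (if h : γ e.2 ∈ τ.dom i then
    (if γ.symm (τ.map i ⟨γ e.2, h⟩) = e.1 then τ.weight i ⟨γ e.2, h⟩ else 0) else 0) = _
  simp only [γ.symm_apply_eq]

theorem mem_graph_pullback {Y : Type v} [TopologicalSpace Y] (τ : WPS d Y) (γ : X ≃ₜ Y)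
    (e : X × X) : e ∈ (τ.pullback γ).graph ↔ (γ e.1, γ e.2) ∈ τ.graph := by
  change (∃ i, ∃ h : γ e.2 ∈ τ.dom i, γ.symm (τ.map i ⟨γ e.2, h⟩) = e.1) ↔ _
  simp only [γ.symm_apply_eq]
  rfl

theorem isCompact_graph [CompactSpace X] (σ : WPS d X) : IsCompact σ.graph := by
  have : σ.graph = ⋃ i, Set.range fun x : σ.dom i => (σ.map i x, (x : X)) := by
    ext ⟨y, x⟩
    simp [graph, and_comm]
  rw [this]
  refine isCompact_iUnion fun i => ?_
  have := isCompact_iff_compactSpace.1 (σ.isClopen_dom i).isClosed.isCompact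
  exact isCompact_range (by fun_prop)

instance [CompactSpace X] (σ : WPS d X) : CompactSpace σ.graph :=
  isCompact_iff_compactSpace.1 σ.isCompact_graph

end Paths

/-! ### Tensor powers as functions on paths -/

section Evaluation

variable {d : ℕ} {X : Type u} [TopologicalSpace X] [CompactSpace X]

/-- Evaluation of continuous functions on the graph at an edge. -/
noncomputable def evalEdge (σ : WPS d X) (e : σ.graph) : σ.corr.carrier →ₗ[ℂ] ℂ :=
  (ContinuousMap.evalCLM ℂ e : C(σ.graph, ℂ) →L[ℂ] ℂ).toLinearMap

/-- The defining sum runs over the indices i, and several i may give the same edge. Grouping them by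
edge collects their weights into `edgeWeight`. -/
theorem inner_corr_apply (σ : WPS d X) (ξ η : σ.corr.carrier) (x : X) :
    σ.corr.inner ξ η x = ∑ e ∈ σ.out x, (σ.edgeWeight e : ℂ) * (star (σ.evalEdge e ξ) * σ.evalEdge e η) := by
  classical
  refine (σ.innerFun_apply ξ η x).trans ?_
  simp only [edgeWeight, Complex.ofReal_sum, Finset.sum_mul]
  rw [Finset.sum_comm]
  refine Finset.sum_congr rfl fun i _ => ?_
  split_ifs with h
  · rw [Finset.sum_eq_single (σ.edge i ⟨x, h⟩)]
    · change star (σ.evalEdge _ ξ) * _ * σ.evalEdge _ η = _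
      simp [edge, h]; ring
    · rintro ⟨⟨y, z⟩, he⟩ h1 h2
      obtain rfl : z = x := (σ.mem_out _ _).1 h1
      have : σ.map i ⟨z, h⟩ ≠ y := fun h' => h2 (Subtype.ext (Prod.ext h'.symm rfl))
      simp [this]
    · intro h'; exact absurd ((σ.mem_out _ _).2 rfl) h'
  · refine (Finset.sum_eq_zero fun e he => ?_).symm
    have : (e : X × X).2 ∉ σ.dom i := by
      rw [show (e : X × X).2 = x from (σ.mem_out _ _).1 he]; exact h
    simp [this]

/-- Evaluation of elements of tensor powers of `C(Gr(σ))` at a tuple of edges,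
`(ξ_n ⊗ ⋯ ⊗ ξ_1)(μ) = ξ_n(μ_n) ⋯ ξ_1(μ_1)`. -/
noncomputable def evalPath (σ : WPS d X) :
    ∀ n : ℕ, (Fin (n + 1) → σ.graph) → (σ.corr.tensorPow (n + 1)).carrier →ₗ[ℂ] ℂ
  | 0, μ => σ.evalEdge (μ 0)
  | n + 1, μ => TensorProduct.lift
      ((LinearMap.mul ℂ ℂ).compl₁₂ (σ.evalEdge (μ (Fin.last (n + 1))))
        (σ.evalPath n (Fin.init μ : Fin (n + 1) → σ.graph)))

theorem evalPath_tmulPow (σ : WPS d X) (n : ℕ) (μ : Fin (n + 2) → σ.graph) (ξ : σ.corr.carrier)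
    (η : (σ.corr.tensorPow (n + 1)).carrier) :
    σ.evalPath (n + 1) μ (σ.corr.tmulPow ξ η) =
      σ.evalEdge (μ (Fin.last (n + 1))) ξ * σ.evalPath n (Fin.init μ : Fin (n + 1) → σ.graph) η :=
  rfl

theorem evalEdge_left (σ : WPS d X) (e : σ.graph) (a : C(X, ℂ)) (ξ : σ.corr.carrier) :
    σ.evalEdge e (σ.corr.left a ξ) = a (σ.range e) * σ.evalEdge e ξ := rfl

/-- The leftmost tensor factor is evaluated at the last edge, so the left action sees only the
endpoint of the path. This is what lets a path be prolonged in the next induction. -/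
theorem evalPath_left (σ : WPS d X) (n : ℕ) (μ : Fin (n + 1) → σ.graph) (a : C(X, ℂ))
    (t : (σ.corr.tensorPow (n + 1)).carrier) :
    σ.evalPath n μ ((σ.corr.tensorPow (n + 1)).left a t) =
      a (σ.range (μ (Fin.last n))) * σ.evalPath n μ t := by
  cases n with
  | zero => rfl
  | succ n =>
    induction t using PreCorr.tensorPow_induction with
    | zero => rw [map_zero, map_zero, mul_zero]
    | add s t hs ht => rw [map_add, map_add, hs, ht, ← mul_add, ← map_add]
    | tmul ξ η =>
      rw [PreCorr.left_tmulPow, evalPath_tmulPow, evalPath_tmulPow, evalEdge_left, mul_assoc]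

/-- Induction on length: in ⟨η, ⟨ξ, ξ'⟩ · η'⟩ the coefficient ⟨ξ, ξ'⟩ is evaluated at the endpoint
of a path μ, where it is itself a sum over the edges leaving that endpoint. Those edges are exactly
the prolongations of μ. -/
theorem inner_tensorPow_apply (σ : WPS d X) (n : ℕ) (s t : (σ.corr.tensorPow (n + 1)).carrier)
    (x : X) : (σ.corr.tensorPow (n + 1)).inner s t x = ∑ μ ∈ σ.paths n x,
      ((∏ k, σ.edgeWeight (μ k) : ℝ) : ℂ) * (star (σ.evalPath n μ s) * σ.evalPath n μ t) := by
  induction n with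
  | zero =>
    rw [sum_paths_zero]
    refine (σ.inner_corr_apply s t x).trans (Finset.sum_congr rfl fun e _ => ?_)
    rw [Fin.prod_univ_one]
    rfl
  | succ n ih =>
    induction s using PreCorr.tensorPow_induction with
    | zero => simp
    | add s s' hs hs' =>
      rw [map_add, LinearMap.add_apply, ContinuousMap.add_apply, hs, hs', ← Finset.sum_add_distrib]
      refine Finset.sum_congr rfl fun μ _ => ?_
      rw [← mul_add, ← add_mul, ← star_add, ← map_add]
    | tmul ξ η =>
      induction t using PreCorr.tensorPow_induction with
      | zero => simp
      | add t t' ht ht' =>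
        rw [map_add, ContinuousMap.add_apply, ht, ht', ← Finset.sum_add_distrib]
        refine Finset.sum_congr rfl fun μ _ => ?_
        rw [← mul_add, ← mul_add, ← map_add]
      | tmul ξ' η' =>
        rw [PreCorr.inner_tmulPow, ih, sum_paths_succ]
        refine Finset.sum_congr rfl fun μ _ => ?_
        rw [evalPath_left, inner_corr_apply, Finset.sum_mul, Finset.mul_sum, Finset.mul_sum]
        refine Finset.sum_congr rfl fun e _ => ?_
        rw [evalPath_tmulPow, evalPath_tmulPow,
          Fin.prod_univ_castSucc fun k => σ.edgeWeight (Fin.snoc (α := fun _ => σ.graph) μ e k)]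
        simp only [Fin.snoc_castSucc, Fin.snoc_last, Fin.init_snoc, star_mul, Complex.ofReal_mul]
        ring

theorem re_inner_tensorPow (σ : WPS d X) (n : ℕ) (t : (σ.corr.tensorPow (n + 1)).carrier)
    (x : X) : ((σ.corr.tensorPow (n + 1)).inner t t x).re = ∑ μ ∈ σ.paths n x,
      (∏ k, σ.edgeWeight (μ k)) * ‖σ.evalPath n μ t‖ ^ 2 := by
  rw [inner_tensorPow_apply, Complex.re_sum]
  refine Finset.sum_congr rfl fun μ _ => ?_
  rw [Complex.star_def, ← Complex.normSq_eq_conj_mul_self, ← Complex.ofReal_mul, Complex.ofReal_re,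
    Complex.normSq_eq_norm_sq]

/-- Take an elementary tensor of bumps, one for each edge of μ. A path different from μ differs from
it in the last edge or in its initial part, and the corresponding factor vanishes there. Finiteness
of S is enough because only finitely many paths start at a given point. -/
theorem exists_evalPath_eq_one [T2Space X] (σ : WPS d X) (n : ℕ) (μ : Fin (n + 1) → σ.graph)
    (S : Finset (Fin (n + 1) → σ.graph)) : ∃ t : (σ.corr.tensorPow (n + 1)).carrier,
      σ.evalPath n μ t = 1 ∧ ∀ ν ∈ S, ν ≠ μ → σ.evalPath n ν t = 0 := by
  classical
  have bump : ∀ (e : σ.graph) (S : Finset σ.graph), ∃ ξ : σ.corr.carrier,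
      σ.evalEdge e ξ = 1 ∧ ∀ f ∈ S, f ≠ e → σ.evalEdge f ξ = 0 := by
    intro e S
    -- Finite sets are closed in the Hausdorff graph, so the finitely many other edges can be cut
    -- away.
    obtain ⟨a, h1, h0, -⟩ := exists_continuous_bump (x := e) (U := (↑(S.erase e) : Set σ.graph)ᶜ)
      (S.erase e).finite_toSet.isClosed.isOpen_compl (by simp)
    exact ⟨a, h1, fun f hf hne => h0 f (by simp [hf, hne])⟩
  induction n with
  | zero =>
    obtain ⟨ξ, h1, h0⟩ := bump (μ 0) (S.image fun ν => ν 0)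
    refine ⟨ξ, h1, fun ν hν hne => h0 _ (Finset.mem_image_of_mem _ hν) fun h => hne ?_⟩
    ext1 i
    rwa [Subsingleton.elim (α := Fin 1) i 0]
  | succ n ih =>
    obtain ⟨ξ, h1, h0⟩ := bump (μ (Fin.last (n + 1))) (S.image fun ν => ν (Fin.last (n + 1)))
    obtain ⟨η, h1', h0'⟩ := ih (Fin.init μ) (S.image fun ν => (Fin.init ν : Fin (n + 1) → σ.graph))
    refine ⟨σ.corr.tmulPow ξ η, ?_, fun ν hν hne => ?_⟩
    · rw [evalPath_tmulPow, h1, h1', mul_one]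
    · rw [evalPath_tmulPow]
      by_cases h : ν (Fin.last (n + 1)) = μ (Fin.last (n + 1))
      · rw [h0' _ (Finset.mem_image_of_mem _ hν), mul_zero]
        intro h'
        apply hne
        rw [← Fin.snoc_init_self ν, ← Fin.snoc_init_self μ, h, h']
      · rw [h0 _ (Finset.mem_image_of_mem (fun ν => ν (Fin.last (n + 1))) hν) h, zero_mul]

end Evaluation

end WPS

/-! ### Tensor powers of weighted composition operators and their norms -/

theorem CorrMap.tensorPow_tmulPow {X : Type u} {Y : Type v} [TopologicalSpace X] [CompactSpace X]
    [TopologicalSpace Y] [CompactSpace Y] {ρ : C(X, ℂ) ≃⋆ₐ[ℂ] C(Y, ℂ)} {E : PreCorr X}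
    {F : PreCorr Y} (V : CorrMap ρ E F) {n : ℕ} (ξ : E.carrier)
    (η : (E.tensorPow (n + 1)).carrier) :
    (V.tensorPow (n + 2)).toLinearMap (E.tmulPow ξ η) =
      F.tmulPow (V.toLinearMap ξ) ((V.tensorPow (n + 1)).toLinearMap η) := rfl

namespace WPS

section Intertwining

variable {d d' : ℕ} {X : Type u} {Y : Type v} [TopologicalSpace X] [CompactSpace X]
  [TopologicalSpace Y] [CompactSpace Y] {σ : WPS d X} {τ : WPS d' Y}
  {ρ : C(X, ℂ) ≃⋆ₐ[ℂ] C(Y, ℂ)} {δ : Y → X} {φ : τ.graph → σ.graph} {h : τ.graph → ℂ}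

theorem comp_mem_paths (hr : ∀ e, σ.range (φ e) = δ (τ.range e))
    (hs : ∀ e, σ.source (φ e) = δ (τ.source e)) {n : ℕ} {y : Y} {ν : Fin (n + 1) → τ.graph}
    (hν : ν ∈ τ.paths n y) : φ ∘ ν ∈ σ.paths n (δ y) := by
  rw [mem_paths] at hν ⊢
  refine ⟨fun k hk => ?_, ?_⟩
  · exact (hr _).trans ((congrArg δ (hν.1 k hk)).trans (hs _).symm)
  · rw [Function.comp_apply, hs, hν.2]

theorem evalPath_corrMap_tensorPow (V : CorrMap ρ σ.corr τ.corr)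
    (hV : ∀ e ξ, τ.evalEdge e (V.toLinearMap ξ) = h e * σ.evalEdge (φ e) ξ) (n : ℕ)
    (ν : Fin (n + 1) → τ.graph) (t : (σ.corr.tensorPow (n + 1)).carrier) :
    τ.evalPath n ν ((V.tensorPow (n + 1)).toLinearMap t) =
      (∏ k, h (ν k)) * σ.evalPath n (φ ∘ ν) t := by
  induction n with
  | zero =>
    rw [Fin.prod_univ_one]
    exact hV _ _
  | succ n ih =>
    induction t using PreCorr.tensorPow_induction with
    | zero => simp
    | add s t hs ht => rw [map_add, map_add, map_add, hs, ht, mul_add]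
    | tmul ξ η =>
      rw [CorrMap.tensorPow_tmulPow, evalPath_tmulPow, evalPath_tmulPow, hV, ih,
        Fin.prod_univ_castSucc fun k => h (ν k)]
      change _ * _ * ((∏ k : Fin (n + 1), h (ν k.castSucc)) *
        σ.evalPath n (Fin.init (φ ∘ ν) : Fin (n + 1) → σ.graph) η) = _
      rw [Function.comp_apply]
      ring

/-- Compare the two path sums term by term. Injectivity of φ makes the images φ ∘ ν distinct paths
starting at δ(y), and any remaining paths there contribute nonnegative terms. Only the relation
between the evaluations of s and t is assumed, so the estimate also proves boundedness of an
operator before it is known to be a `CorrMap`. -/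
theorem norm_le_sqrt_mul_norm (hr : ∀ e, σ.range (φ e) = δ (τ.range e))
    (hs : ∀ e, σ.source (φ e) = δ (τ.source e)) (hφ : Function.Injective φ) {C : ℝ} (hC : 0 ≤ C)
    {n : ℕ} {s : (τ.corr.tensorPow (n + 1)).carrier} {t : (σ.corr.tensorPow (n + 1)).carrier}
    (hst : ∀ ν, τ.evalPath n ν s = (∏ k, h (ν k)) * σ.evalPath n (φ ∘ ν) t)
    (hh : ∀ ν : Fin (n + 1) → τ.graph, τ.IsPath ν →
      ∏ k, (τ.edgeWeight (ν k) * ‖h (ν k)‖ ^ 2) ≤ C * ∏ k, σ.edgeWeight (φ (ν k))) :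
    ‖s‖ ≤ √C * ‖t‖ := by
  classical
  rw [PreCorr.norm_le_iff _ _ (by positivity)]
  intro y
  rw [mul_pow, Real.sq_sqrt hC]
  refine le_trans ?_ (mul_le_mul_of_nonneg_left (PreCorr.re_inner_le _ t (δ y)) hC)
  rw [re_inner_tensorPow, re_inner_tensorPow, Finset.mul_sum]
  have hinj : Function.Injective fun ν : Fin (n + 1) → τ.graph => φ ∘ ν := hφ.comp_left
  calc _ ≤ ∑ ν ∈ τ.paths n y, C * ((∏ k, σ.edgeWeight ((φ ∘ ν) k)) *
        ‖σ.evalPath n (φ ∘ ν) t‖ ^ 2) := by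
        refine Finset.sum_le_sum fun ν hν => ?_
        rw [hst, norm_mul, mul_pow, norm_prod, ← Finset.prod_pow, ← mul_assoc,
          ← Finset.prod_mul_distrib, ← mul_assoc]
        exact mul_le_mul_of_nonneg_right (hh ν ((τ.mem_paths n y ν).1 hν).1) (sq_nonneg _)
    _ = ∑ μ ∈ (τ.paths n y).image fun ν => φ ∘ ν, C * ((∏ k, σ.edgeWeight (μ k)) *
        ‖σ.evalPath n μ t‖ ^ 2) := by
        rw [Finset.sum_image hinj.injOn]
    _ ≤ _ := by
        refine Finset.sum_le_sum_of_subset_of_nonneg ?_ fun μ _ _ => ?_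
        · intro μ hμ
          obtain ⟨ν, hν, rfl⟩ := Finset.mem_image.1 hμ
          exact comp_mem_paths hr hs hν
        · exact mul_nonneg hC (mul_nonneg
            (Finset.prod_nonneg fun k _ => σ.edgeWeight_nonneg _) (sq_nonneg _))

theorem norm_power_le (V : CorrMap ρ σ.corr τ.corr)
    (hV : ∀ e ξ, τ.evalEdge e (V.toLinearMap ξ) = h e * σ.evalEdge (φ e) ξ)
    (hr : ∀ e, σ.range (φ e) = δ (τ.range e))
    (hs : ∀ e, σ.source (φ e) = δ (τ.source e)) (hφ : Function.Injective φ) {C : ℝ} (hC : 0 ≤ C)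
    {n : ℕ} (hh : ∀ ν : Fin (n + 1) → τ.graph, τ.IsPath ν →
      ∏ k, (τ.edgeWeight (ν k) * ‖h (ν k)‖ ^ 2) ≤ C * ∏ k, σ.edgeWeight (φ (ν k))) :
    ‖V.power (n + 1)‖ ^ 2 ≤ C := by
  have := V.norm_power_le (n + 1) (Real.sqrt_nonneg C) fun t =>
    norm_le_sqrt_mul_norm hr hs hφ hC (fun ν => evalPath_corrMap_tensorPow V hV n ν t) hh
  calc _ ≤ √C ^ 2 := pow_le_pow_left₀ (norm_nonneg _) this 2
    _ = C := Real.sq_sqrt hC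

/-- Apply the pointwise form of the norm bound to an element t equal to 1 on φ ∘ ν and 0 on every
other path starting at δ(y). On the σ side a single weight product survives; on the τ side all terms
but that of ν are dropped. -/
theorem prod_le_norm_power_sq [T2Space X] (V : CorrMap ρ σ.corr τ.corr)
    (hρ : ∀ f y, ρ f y = f (δ y))
    (hV : ∀ e ξ, τ.evalEdge e (V.toLinearMap ξ) = h e * σ.evalEdge (φ e) ξ)
    (hr : ∀ e, σ.range (φ e) = δ (τ.range e)) (hs : ∀ e, σ.source (φ e) = δ (τ.source e))
    {n : ℕ} {ν : Fin (n + 1) → τ.graph} (hν : τ.IsPath ν) :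
    ∏ k, (τ.edgeWeight (ν k) * ‖h (ν k)‖ ^ 2) ≤
      ‖V.power (n + 1)‖ ^ 2 * ∏ k, σ.edgeWeight (φ (ν k)) := by
  set y := τ.source (ν 0)
  have hνy : ν ∈ τ.paths n y := (τ.mem_paths _ _ _).2 ⟨hν, rfl⟩
  obtain ⟨t, h1, h0⟩ := σ.exists_evalPath_eq_one n (φ ∘ ν) (σ.paths n (δ y))
  have key := (V.tensorPow (n + 1)).re_inner_le_of_norm_le hρ (V.norm_tensorPow_le (n + 1))
    (norm_nonneg _) t y
  rw [re_inner_tensorPow, re_inner_tensorPow,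
    Finset.sum_eq_single (φ ∘ ν) (fun μ hμ hne => by rw [h0 μ hμ hne]; simp)
      (fun h => absurd (comp_mem_paths hr hs hνy) h), h1, norm_one, one_pow, mul_one] at key
  refine le_trans ?_ key
  refine le_trans (le_of_eq ?_) (Finset.single_le_sum (fun μ _ => mul_nonneg
    (Finset.prod_nonneg fun k _ => τ.edgeWeight_nonneg _) (sq_nonneg _)) hνy)
  rw [evalPath_corrMap_tensorPow V hV, h1, mul_one, norm_prod, ← Finset.prod_pow,
    ← Finset.prod_mul_distrib]

end Intertwining

/-! ### The zeroth tensor power -/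

section Regular

variable {X : Type u} {Y : Type v} [TopologicalSpace X] [CompactSpace X] [TopologicalSpace Y]
  [CompactSpace Y] {ρ : C(X, ℂ) ≃⋆ₐ[ℂ] C(Y, ℂ)} {E : PreCorr X} {F : PreCorr Y}

theorem _root_.CorrMap.norm_power_zero_le (V : CorrMap ρ E F) : ‖V.power 0‖ ≤ 1 :=
  V.norm_power_le 0 zero_le_one (CorrMap.bounded_of_dominated (ρ := ρ)
    (CorrMap.regular ρ).toLinearMap zero_le_one fun (ξ : C(X, ℂ)) => by
    change star (ρ ξ) * ρ ξ ≤ _ • ρ (star ξ * ξ)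
    rw [map_mul, map_star]; simp)

theorem _root_.CorrMap.one_le_norm_power_zero [Nonempty X] [Nonempty Y] (V : CorrMap ρ E F) :
    1 ≤ ‖V.power 0‖ := by
  have h := V.norm_tensorPow_le 0 (1 : C(X, ℂ))
  change √‖star (ρ 1) * ρ 1‖ ≤ _ * √‖star (1 : C(X, ℂ)) * 1‖ at h
  simpa using h

end Regular

end WPS

namespace WPS

/-! ### Bimodule maps are weighted composition operators -/

section Locality

variable {d d' : ℕ} {X : Type u} {Y : Type v} [TopologicalSpace X] [CompactSpace X]
  [TopologicalSpace Y] [CompactSpace Y] {σ : WPS d X} {τ : WPS d' Y}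
  {ρ : C(X, ℂ) ≃⋆ₐ[ℂ] C(Y, ℂ)} {δ : Y → X}

theorem re_inner_corr (σ : WPS d X) (ξ : σ.corr.carrier) (x : X) :
    (σ.corr.inner ξ ξ x).re = ∑ e ∈ σ.out x, σ.edgeWeight e * ‖σ.evalEdge e ξ‖ ^ 2 := by
  rw [inner_corr_apply, Complex.re_sum]
  refine Finset.sum_congr rfl fun e _ => ?_
  rw [Complex.star_def, ← Complex.normSq_eq_conj_mul_self, ← Complex.ofReal_mul, Complex.ofReal_re,
    Complex.normSq_eq_norm_sq]

/-- The constant function `1` as an element of `C(σ, w)`. -/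
noncomputable def corrOne (σ : WPS d X) : σ.corr.carrier := (1 : C(σ.graph, ℂ))

@[simp] theorem evalEdge_corrOne (σ : WPS d X) (e : σ.graph) : σ.evalEdge e σ.corrOne = 1 := rfl

/-- With `evalEdge_sq_le`, this compares the module norm with uniform and pointwise size on edges,
as needed for the locality argument. -/
theorem norm_corr_le (σ : WPS d X) {ξ : σ.corr.carrier} {ε : ℝ} (hε : 0 ≤ ε)
    (h : ∀ e, ‖σ.evalEdge e ξ‖ ≤ ε) :
    ‖ξ‖ ≤ ε * ‖σ.corrOne‖ := by
  rw [PreCorr.norm_le_iff _ _ (mul_nonneg hε (PreCorr.norm_nonneg' _ _))]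
  intro x
  have h1 := σ.corr.re_inner_le σ.corrOne x
  rw [mul_pow]
  refine le_trans ?_ (mul_le_mul_of_nonneg_left h1 (sq_nonneg ε))
  rw [re_inner_corr, re_inner_corr, Finset.mul_sum]
  refine Finset.sum_le_sum fun e _ => ?_
  rw [evalEdge_corrOne, norm_one, one_pow, mul_one, mul_comm]
  exact mul_le_mul_of_nonneg_right (pow_le_pow_left₀ (norm_nonneg _) (h e) 2)
    (σ.edgeWeight_nonneg _)

theorem evalEdge_sq_le (σ : WPS d X) (ξ : σ.corr.carrier) (e : σ.graph) :
    σ.edgeWeight e * ‖σ.evalEdge e ξ‖ ^ 2 ≤ ‖ξ‖ ^ 2 := by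
  refine le_trans ?_ (σ.corr.re_inner_le ξ (σ.source e))
  rw [re_inner_corr]
  exact Finset.single_le_sum
    (f := fun e : σ.graph => σ.edgeWeight e * ‖σ.evalEdge e ξ‖ ^ 2)
    (fun f _ => mul_nonneg (σ.edgeWeight_nonneg _) (sq_nonneg _)) ((σ.mem_out _ _).2 rfl)

/-- Bimodule maps are local: `(V ξ)(e)` depends only on the value of `ξ` at the edge corresponding
to `e`, and vanishes if there is no such edge. -/
theorem evalEdge_corrMap_eq_zero [T2Space X] (V : CorrMap ρ σ.corr τ.corr)
    (hρ : ∀ f y, ρ f y = f (δ y)) (e : τ.graph) (ξ : σ.corr.carrier)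
    (hξ : ∀ f : σ.graph, (f : X × X) = (δ (τ.range e), δ (τ.source e)) → σ.evalEdge f ξ = 0) :
    τ.evalEdge e (V.toLinearMap ξ) = 0 := by
  obtain ⟨K, hK⟩ := V.bounded
  set M := ‖σ.corrOne‖
  have hM : 0 ≤ M := PreCorr.norm_nonneg' _ _
  have hu := τ.edgeWeight_pos e
  have hcont : Continuous fun f => σ.evalEdge f ξ := ContinuousMap.continuous (ξ : C(σ.graph, ℂ))
  have key : ∀ ε : ℝ, 0 < ε →
      τ.edgeWeight e * ‖τ.evalEdge e (V.toLinearMap ξ)‖ ^ 2 ≤ (|K| * (ε * M)) ^ 2 := by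
    intro ε hε
    -- S is the set of edges where ξ is not small. It is closed because the graph is compact, and it
    -- misses the point corresponding to e. A product neighbourhood A × B of that point avoids S, so
    -- bumps in A on the left and in B on the right make ξ uniformly at most ε without changing the
    -- value of its image at e.
    let S : Set (X × X) := Subtype.val '' {f : σ.graph | ε ≤ ‖σ.evalEdge f ξ‖}
    have hS : IsClosed S :=
      ((isClosed_le continuous_const hcont.norm).isCompact.image continuous_subtype_val).isClosed
    have hp : (δ (τ.range e), δ (τ.source e)) ∈ Sᶜ := by
      rintro ⟨f, hf, hfe⟩
      rw [Set.mem_ofPred_eq, hξ f hfe, norm_zero] at hf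
      exact hf.not_gt hε
    obtain ⟨A, B, hA, hB, hxA, hxB, hAB⟩ := isOpen_prod_iff.1 hS.isOpen_compl _ _ hp
    obtain ⟨a, ha1, ha0, ha⟩ := exists_continuous_bump hA hxA
    obtain ⟨b, hb1, hb0, hb⟩ := exists_continuous_bump hB hxB
    have h1 : ‖σ.corr.left a (σ.corr.right b ξ)‖ ≤ ε * M := by
      refine norm_corr_le σ hε.le fun f => ?_
      have h2 : σ.evalEdge f (σ.corr.left a (σ.corr.right b ξ)) =
        a (σ.range f) * (b (σ.source f) * σ.evalEdge f ξ) := rfl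
      rw [h2]
      by_cases hfA : σ.range f ∈ A
      · by_cases hfB : σ.source f ∈ B
        · have h3 : ‖σ.evalEdge f ξ‖ ≤ ε := by
            by_contra! h
            exact hAB (Set.mk_mem_prod hfA hfB) ⟨f, h.le, rfl⟩
          rw [norm_mul, norm_mul]
          calc _ ≤ 1 * (1 * ε) := by gcongr <;> [exact ha _; exact hb _]
            _ = ε := by ring
        · rw [hb0 _ hfB]; simpa using hε.le
      · rw [ha0 _ hfA]; simpa using hε.le
    have h4 : τ.evalEdge e (V.toLinearMap (σ.corr.left a (σ.corr.right b ξ))) =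
        τ.evalEdge e (V.toLinearMap ξ) := by
      rw [V.map_left, V.map_right]
      change ρ a (τ.range e) * (ρ b (τ.source e) * τ.evalEdge e (V.toLinearMap ξ)) = _
      rw [hρ, hρ, ha1, hb1, one_mul, one_mul]
    rw [← h4]
    refine (τ.evalEdge_sq_le _ e).trans (pow_le_pow_left₀ (PreCorr.norm_nonneg' _ _) ?_ 2)
    exact (hK _).trans (mul_le_mul (le_abs_self K) h1 (PreCorr.norm_nonneg' _ _) (abs_nonneg K))
  have h5 : τ.edgeWeight e * ‖τ.evalEdge e (V.toLinearMap ξ)‖ ^ 2 ≤ 0 := by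
    -- Let ε tend to 0; positivity of the weight of e then forces the value at e to vanish.
    have ht : Filter.Tendsto (fun ε : ℝ => (|K| * (ε * M)) ^ 2) (nhdsWithin 0 (Set.Ioi 0))
        (nhds ((|K| * (0 * M)) ^ 2)) :=
      (Continuous.tendsto (by fun_prop) 0).mono_left nhdsWithin_le_nhds
    have := ge_of_tendsto ht (by filter_upwards [self_mem_nhdsWithin] with ε hε using key ε hε)
    simpa using this
  have h6 : ‖τ.evalEdge e (V.toLinearMap ξ)‖ ^ 2 = 0 :=
    le_antisymm (nonpos_of_mul_nonpos_right h5 hu) (sq_nonneg _)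
  simpa using h6

/-- Without a corresponding edge, locality would make every Vξ vanish at e, yet the constant
function 1 is in the range of V. -/
theorem mem_graph_of_surjective [T2Space X] (V : CorrMap ρ σ.corr τ.corr)
    (hρ : ∀ f y, ρ f y = f (δ y)) (hV : Function.Surjective V.toLinearMap) (e : τ.graph) :
    (δ (τ.range e), δ (τ.source e)) ∈ σ.graph := by
  by_contra hne
  obtain ⟨ξ, hξ⟩ := hV τ.corrOne
  have := evalEdge_corrMap_eq_zero V hρ e ξ fun f hf => absurd (hf ▸ f.2) hne
  rw [hξ] at this
  exact one_ne_zero (α := ℂ) this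

/-- A bimodule map is a weighted composition operator. -/
theorem evalEdge_corrMap [T2Space X] (V : CorrMap ρ σ.corr τ.corr)
    (hρ : ∀ f y, ρ f y = f (δ y)) {e : τ.graph} {f : σ.graph}
    (hf : (f : X × X) = (δ (τ.range e), δ (τ.source e))) (ξ : σ.corr.carrier) :
    τ.evalEdge e (V.toLinearMap ξ) =
      τ.evalEdge e (V.toLinearMap σ.corrOne) * σ.evalEdge f ξ := by
  -- Locality is applied to ξ minus the constant ξ(f), which vanishes at f.
  have := evalEdge_corrMap_eq_zero V hρ e (ξ - σ.evalEdge f ξ • σ.corrOne) fun f' hf' => by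
    obtain rfl : f' = f := Subtype.ext (hf'.trans hf.symm)
    rw [map_sub, map_smul, evalEdge_corrOne, smul_eq_mul, mul_one, sub_self]
  rw [map_sub, map_smul, map_sub, map_smul, sub_eq_zero, smul_eq_mul] at this
  rw [this, mul_comm]

end Locality

/-! ### Construction of weighted composition operators -/

section WeightedComposition

variable {d d' : ℕ} {X : Type u} {Y : Type v} [TopologicalSpace X] [CompactSpace X]
  [TopologicalSpace Y] [CompactSpace Y] {σ : WPS d X} {τ : WPS d' Y}
  {ρ : C(X, ℂ) ≃⋆ₐ[ℂ] C(Y, ℂ)} {δ : Y → X}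

/-- The weighted composition operator `ξ ↦ h · (ξ ∘ φ)`. -/
noncomputable def weightedComp (hρ : ∀ f y, ρ f y = f (δ y)) (φ : C(τ.graph, σ.graph))
    (h : C(τ.graph, ℂ)) (hr : ∀ e, σ.range (φ e) = δ (τ.range e))
    (hs : ∀ e, σ.source (φ e) = δ (τ.source e)) (hφ : Function.Injective φ) {C : ℝ} (hC : 0 ≤ C)
    (hh : ∀ e : τ.graph, τ.edgeWeight e * ‖h e‖ ^ 2 ≤ C * σ.edgeWeight (φ e)) :
    CorrMap ρ σ.corr τ.corr where
  toLinearMap := (LinearMap.mulLeft ℂ h ∘ₗ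
    (ContinuousMap.compStarAlgHom' ℂ ℂ φ).toAlgHom.toLinearMap :
      C(σ.graph, ℂ) →ₗ[ℂ] C(τ.graph, ℂ))
  map_left a (ξ : C(σ.graph, ℂ)) := by
    refine ContinuousMap.ext fun e => ?_
    change h e * (a (σ.range (φ e)) * ξ (φ e)) = ρ a (τ.range e) * (h e * ξ (φ e))
    rw [hρ, hr, mul_left_comm]
  map_right a (ξ : C(σ.graph, ℂ)) := by
    refine ContinuousMap.ext fun e => ?_
    change h e * (a (σ.source (φ e)) * ξ (φ e)) = ρ a (τ.source e) * (h e * ξ (φ e))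
    rw [hρ, hs, mul_left_comm]
  -- Here n = 0 means paths of length one, that is, single edges.
  bounded := ⟨√C, fun ξ => norm_le_sqrt_mul_norm (n := 0) (h := h) hr hs hφ hC
    (fun ν => by rw [Fin.prod_univ_one]; rfl)
    (fun ν _ => by rw [Fin.prod_univ_one, Fin.prod_univ_one]; exact hh (ν 0))⟩

theorem evalEdge_weightedComp (hρ : ∀ f y, ρ f y = f (δ y)) (φ : C(τ.graph, σ.graph))
    (h : C(τ.graph, ℂ)) (hr : ∀ e, σ.range (φ e) = δ (τ.range e))
    (hs : ∀ e, σ.source (φ e) = δ (τ.source e)) (hφ : Function.Injective φ) {C : ℝ} (hC : 0 ≤ C)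
    (hh : ∀ e : τ.graph, τ.edgeWeight e * ‖h e‖ ^ 2 ≤ C * σ.edgeWeight (φ e)) (e : τ.graph)
    (ξ : σ.corr.carrier) :
    τ.evalEdge e ((weightedComp hρ φ h hr hs hφ hC hh).toLinearMap ξ) =
      h e * σ.evalEdge (φ e) ξ := rfl

end WeightedComposition

end WPS

/-! ### Division-free forms of the conjugacy inequalities -/

theorem prod_div_mul_le_iff {n : ℕ} {C : ℝ} {a b c : Fin n → ℝ} (hb : ∀ k, 0 < b k) :
    ∏ k, (a k / b k * c k) ≤ C ↔ ∏ k, (a k * c k) ≤ C * ∏ k, b k := by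
  rw [← div_le_iff₀ (Finset.prod_pos fun k _ => hb k), ← Finset.prod_div_distrib]
  simp only [div_mul_eq_mul_div]

/-- Taking reciprocals turns the lower bound into an upper bound with the two weights exchanged and
H replaced by 1/H, which is the estimate for V⁻¹. -/
theorem one_div_le_prod_div_mul_iff {n : ℕ} {C : ℝ} (hC : 0 < C) {a b c : Fin n → ℝ}
    (hb : ∀ k, 0 < b k) (hc : ∀ k, 0 < c k) :
    1 / C ≤ ∏ k, (a k / b k * c k) ↔ ∏ k, (b k * (c k)⁻¹) ≤ C * ∏ k, a k := by
  have hb' : 0 < ∏ k, b k := Finset.prod_pos fun k _ => hb k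
  have hc' : 0 < ∏ k, c k := Finset.prod_pos fun k _ => hc k
  rw [Finset.prod_mul_distrib, Finset.prod_mul_distrib, Finset.prod_inv_distrib,
    Finset.prod_div_distrib, ← div_eq_mul_inv, div_le_iff₀ hc', div_mul_eq_mul_div,
    div_le_div_iff₀ hC hb', one_mul]
  ring_nf

/-! ### From weighted-orbit conjugacy to similarity -/

namespace WPS

section EdgeMap

variable {d d' : ℕ} {X : Type u} {Y : Type v} [TopologicalSpace X] [TopologicalSpace Y]
  {σ : WPS d X} {τ : WPS d' Y}

/-- The map `(y, x) ↦ (δ(y), δ(x))` between graphs. -/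
def edgeMap (δ : C(Y, X)) (h : ∀ e : τ.graph, (δ (τ.range e), δ (τ.source e)) ∈ σ.graph) :
    C(τ.graph, σ.graph) where
  toFun e := ⟨(δ (τ.range e), δ (τ.source e)), h e⟩
  continuous_toFun := by fun_prop

theorem isPath_edgeMap (δ : C(Y, X))
    (h : ∀ e : τ.graph, (δ (τ.range e), δ (τ.source e)) ∈ σ.graph) {n : ℕ}
    {ν : Fin n → τ.graph} (hν : τ.IsPath ν) : σ.IsPath fun k => edgeMap δ h (ν k) :=
  fun k hk => congrArg δ (hν k hk)

theorem edgeMap_edgeMap {δ : C(Y, X)} {ε : C(X, Y)} (hδε : ∀ x, δ (ε x) = x)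
    (hδ : ∀ e : τ.graph, (δ (τ.range e), δ (τ.source e)) ∈ σ.graph)
    (hε : ∀ e : σ.graph, (ε (σ.range e), ε (σ.source e)) ∈ τ.graph) (e : σ.graph) :
    edgeMap δ hδ (edgeMap ε hε e) = e :=
  Subtype.ext (Prod.ext (hδε _) (hδε _))

end EdgeMap

variable {d d' : ℕ} {X : Type u} {Y : Type v} [TopologicalSpace X] [CompactSpace X]
  [TopologicalSpace Y] [CompactSpace Y] {σ : WPS d X} {τ : WPS d' Y} {γ : X ≃ₜ Y}

theorem exists_similarity_of_weightedOrbitConj {C : ℝ} (hconj : σ.WeightedOrbitConj τ γ C) :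
    ∃ V : Similarity (γ.symm.compStarAlgEquiv' ℂ ℂ) σ.corr τ.corr, V.const ≤ C := by
  obtain ⟨hC1, hG, H, hH⟩ := hconj
  have hC : 0 < C := by linarith
  have hψ : ∀ e : σ.graph, (γ (σ.range e), γ (σ.source e)) ∈ τ.graph := fun e =>
    (τ.mem_graph_pullback γ e).1 (hG ▸ e.2)
  have hφ : ∀ e : τ.graph, (γ.symm (τ.range e), γ.symm (τ.source e)) ∈ σ.graph := fun e => by
    rw [hG, mem_graph_pullback, γ.apply_symm_apply, γ.apply_symm_apply]
    exact e.2
  let φ : C(τ.graph, σ.graph) := edgeMap (γ.symm : C(Y, X)) hφ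
  let ψ : C(σ.graph, τ.graph) := edgeMap (γ : C(X, Y)) hψ
  have hφψ : ∀ e, φ (ψ e) = e := edgeMap_edgeMap (fun x => γ.symm_apply_apply x) hφ hψ
  have hψφ : ∀ e, ψ (φ e) = e := edgeMap_edgeMap (fun y => γ.apply_symm_apply y) hψ hφ
  have hu : ∀ e : σ.graph, (τ.pullback γ).edgeWeight e = τ.edgeWeight (ψ e) := fun e =>
    τ.edgeWeight_pullback γ e
  simp only [hu] at hH
  -- H is only assumed continuous and real; its positivity comes from the lower bound on paths of
  -- length one.
  have hHpos : ∀ e, 0 < H e := fun e => by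
    have h := (hH 1 (fun _ => e) fun k hk => by omega).1
    rw [Fin.prod_univ_one] at h
    exact (mul_pos_iff_of_pos_left (div_pos (τ.edgeWeight_pos _) (σ.edgeWeight_pos _))).1
      ((one_div_pos.2 hC).trans_le h)
  -- The norm of V^{⊗n} involves |h|², so h must be a square root of H carried to Gr(τ); k is the
  -- reciprocal multiplier, for the inverse.
  let h : C(τ.graph, ℂ) := ⟨fun e => (√(H (φ e)) : ℝ), by fun_prop⟩
  let k : C(σ.graph, ℂ) := ⟨fun e => ((√(H e))⁻¹ : ℝ), Complex.continuous_ofReal.comp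
    (Continuous.inv₀ (by fun_prop) fun e => (Real.sqrt_pos.2 (hHpos e)).ne')⟩
  have hh : ∀ e, ‖h e‖ ^ 2 = H (φ e) := fun e => by
    change ‖((√(H (φ e)) : ℝ) : ℂ)‖ ^ 2 = _
    rw [Complex.norm_real, Real.norm_eq_abs, sq_abs, Real.sq_sqrt (hHpos _).le]
  have hk : ∀ e, ‖k e‖ ^ 2 = (H e)⁻¹ := fun e => by
    change ‖(((√(H e))⁻¹ : ℝ) : ℂ)‖ ^ 2 = _
    rw [Complex.norm_real, Real.norm_eq_abs, sq_abs, inv_pow, Real.sq_sqrt (hHpos _).le]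
  have hkh : ∀ e, k e * h (ψ e) = 1 := fun e => by
    change (((√(H e))⁻¹ : ℝ) : ℂ) * ((√(H (φ (ψ e))) : ℝ) : ℂ) = 1
    rw [hφψ, ← Complex.ofReal_mul, inv_mul_cancel₀ (Real.sqrt_pos.2 (hHpos e)).ne',
      Complex.ofReal_one]
  have upper : ∀ (n : ℕ) (ν : Fin n → τ.graph), τ.IsPath ν →
      ∏ i, (τ.edgeWeight (ν i) * ‖h (ν i)‖ ^ 2) ≤ C * ∏ i, σ.edgeWeight (φ (ν i)) := by
    intro n ν hν
    have := (prod_div_mul_le_iff fun i => σ.edgeWeight_pos (φ (ν i))).1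
      (hH n _ (isPath_edgeMap _ hφ hν)).2
    simpa only [hh, show ∀ e, ψ (edgeMap (γ.symm : C(Y, X)) hφ e) = e from hψφ] using this
  have lower : ∀ (n : ℕ) (μ : Fin n → σ.graph), σ.IsPath μ →
      ∏ i, (σ.edgeWeight (μ i) * ‖k (μ i)‖ ^ 2) ≤ C * ∏ i, τ.edgeWeight (ψ (μ i)) := by
    intro n μ hμ
    have := (one_div_le_prod_div_mul_iff hC (fun i => σ.edgeWeight_pos (μ i))
      fun i => hHpos (μ i)).1 (hH n μ hμ).1
    simpa only [hk] using this
  let V : CorrMap (γ.symm.compStarAlgEquiv' ℂ ℂ) σ.corr τ.corr :=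
    weightedComp (δ := γ.symm) (fun _ _ => rfl) φ h (fun _ => rfl) (fun _ => rfl)
      (Function.LeftInverse.injective hψφ) hC.le fun e => by
        have := upper 1 (fun _ => e) fun k hk => by omega
        rwa [Fin.prod_univ_one, Fin.prod_univ_one] at this
  let W : CorrMap (γ.symm.compStarAlgEquiv' ℂ ℂ).symm τ.corr σ.corr :=
    weightedComp (δ := γ) (fun _ _ => rfl) ψ k (fun _ => rfl) (fun _ => rfl)
      (Function.LeftInverse.injective hφψ) hC.le fun e => by
        have := lower 1 (fun _ => e) fun k hk => by omega
        rwa [Fin.prod_univ_one, Fin.prod_univ_one] at this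
  -- The power 0 is ρ, of norm at most 1, and is covered by 1 ≤ C rather than by a path estimate.
  have hV : ∀ n, ‖V.power n‖ ^ 2 ≤ C
    | 0 => (pow_le_one₀ (norm_nonneg _) V.norm_power_zero_le).trans hC1
    | n + 1 => norm_power_le V (evalEdge_weightedComp _ _ _ _ _ _ _ _) (δ := γ.symm)
        (fun _ => rfl) (fun _ => rfl) (Function.LeftInverse.injective hψφ) hC.le (upper (n + 1))
  have hW : ∀ n, ‖W.power n‖ ^ 2 ≤ C
    | 0 => (pow_le_one₀ (norm_nonneg _) W.norm_power_zero_le).trans hC1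
    | n + 1 => norm_power_le W (evalEdge_weightedComp _ _ _ _ _ _ _ _) (δ := γ)
        (fun _ => rfl) (fun _ => rfl) (Function.LeftInverse.injective hφψ) hC.le (lower (n + 1))
  refine ⟨⟨V, W, fun ξ => ?_, fun η => ?_, ⟨√C, fun n => Real.le_sqrt_of_sq_le (hV n)⟩,
    ⟨√C, fun n => Real.le_sqrt_of_sq_le (hW n)⟩⟩, ciSup_le fun n => max_le (hV n) (hW n)⟩
  · refine ContinuousMap.ext fun e => ?_
    change k e * (h (ψ e) * σ.evalEdge (φ (ψ e)) ξ) = σ.evalEdge e ξ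
    rw [← mul_assoc, hkh, one_mul, hφψ]
  · refine ContinuousMap.ext fun e => ?_
    change h e * (k (φ e) * τ.evalEdge (ψ (φ e)) η) = τ.evalEdge e η
    have := hkh (φ e)
    rw [hψφ] at this ⊢
    rw [← mul_assoc, mul_comm (h e), this, one_mul]

end WPS

/-! ### From similarity to weighted-orbit conjugacy -/

section Const

variable {X : Type u} {Y : Type v} [TopologicalSpace X] [CompactSpace X] [TopologicalSpace Y]
  [CompactSpace Y] {ρ : C(X, ℂ) ≃⋆ₐ[ℂ] C(Y, ℂ)} {E : PreCorr X} {F : PreCorr Y}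

/-- Power boundedness enters here: a real supremum dominates its terms only when the family is
bounded above. -/
theorem Similarity.max_norm_power_sq_le_const (V : Similarity ρ E F) (n : ℕ) :
    max (‖V.map.power n‖ ^ 2) (‖V.inv.power n‖ ^ 2) ≤ V.const := by
  obtain ⟨K, hK⟩ := V.map_powerBounded
  obtain ⟨L, hL⟩ := V.inv_powerBounded
  refine le_ciSup (f := fun n => max (‖V.map.power n‖ ^ 2) (‖V.inv.power n‖ ^ 2))
    ⟨max (K ^ 2) (L ^ 2), ?_⟩ n
  rintro _ ⟨n, rfl⟩
  exact max_le_max (pow_le_pow_left₀ (norm_nonneg _) (hK n) 2)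
    (pow_le_pow_left₀ (norm_nonneg _) (hL n) 2)

end Const

namespace WPS

variable {d d' : ℕ} {X : Type u} {Y : Type v} [TopologicalSpace X] [CompactSpace X]
  [TopologicalSpace Y] [CompactSpace Y] {σ : WPS d X} {τ : WPS d' Y} {γ : X ≃ₜ Y}

theorem weightedOrbitConj_of_similarity [T2Space X] [T2Space Y] [Nonempty X]
    (V : Similarity (γ.symm.compStarAlgEquiv' ℂ ℂ) σ.corr τ.corr) :
    σ.WeightedOrbitConj τ γ V.const := by
  have : Nonempty Y := γ.toEquiv.nonempty_congr.1 ‹_›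
  have hmap : ∀ n, ‖V.map.power n‖ ^ 2 ≤ V.const := fun n =>
    (le_max_left _ _).trans (V.max_norm_power_sq_le_const n)
  have hinv : ∀ n, ‖V.inv.power n‖ ^ 2 ≤ V.const := fun n =>
    (le_max_right _ _).trans (V.max_norm_power_sq_le_const n)
  -- The power 0 sends the unit to the unit, and on non-empty spaces the unit has norm 1.
  have hC1 : 1 ≤ V.const := (one_le_pow₀ V.map.one_le_norm_power_zero).trans (hmap 0)
  have hC : 0 < V.const := by linarith
  have hρ : ∀ f y, γ.symm.compStarAlgEquiv' ℂ ℂ f y = f (γ.symm y) := fun _ _ => rfl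
  have hρ' : ∀ f x, (γ.symm.compStarAlgEquiv' ℂ ℂ).symm f x = f (γ x) := fun _ _ => rfl
  -- Surjectivity of V and of its inverse gives the two inclusions between the graphs.
  have hφ := mem_graph_of_surjective V.map hρ fun η => ⟨_, V.right_inv η⟩
  have hψ := mem_graph_of_surjective V.inv hρ' fun ξ => ⟨_, V.left_inv ξ⟩
  let φ : C(τ.graph, σ.graph) := edgeMap (γ.symm : C(Y, X)) hφ
  let ψ : C(σ.graph, τ.graph) := edgeMap (γ : C(X, Y)) hψ
  have hφψ : ∀ e, φ (ψ e) = e := edgeMap_edgeMap (fun x => γ.symm_apply_apply x) hφ hψ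
  have hu : ∀ e : σ.graph, (τ.pullback γ).edgeWeight e = τ.edgeWeight (ψ e) := fun e =>
    τ.edgeWeight_pullback γ e
  let h : C(τ.graph, ℂ) := V.map.toLinearMap σ.corrOne
  let k : C(σ.graph, ℂ) := V.inv.toLinearMap τ.corrOne
  have hV : ∀ e ξ, τ.evalEdge e (V.map.toLinearMap ξ) = h e * σ.evalEdge (φ e) ξ :=
    fun e ξ => evalEdge_corrMap V.map hρ rfl ξ
  have hW : ∀ e η, σ.evalEdge e (V.inv.toLinearMap η) = k e * τ.evalEdge (ψ e) η :=
    fun e η => evalEdge_corrMap V.inv hρ' rfl η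
  -- Evaluate V⁻¹(V(1)) = 1 at e. In particular h has no zeros, so H below is positive.
  have hkh : ∀ e, k e * h (ψ e) = 1 := fun e => by
    have := hW e (V.map.toLinearMap σ.corrOne)
    rw [V.left_inv, hV, evalEdge_corrOne, evalEdge_corrOne, mul_one] at this
    exact this.symm
  have hk : ∀ e, (‖h (ψ e)‖ ^ 2)⁻¹ = ‖k e‖ ^ 2 := fun e => by
    refine inv_eq_of_mul_eq_one_right ?_
    rw [← mul_pow, ← norm_mul, mul_comm, hkh, norm_one, one_pow]
  refine ⟨hC1, ?_, ⟨fun e => ‖h (ψ e)‖ ^ 2, by fun_prop⟩, fun n μ hμ => ?_⟩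
  · ext e
    rw [mem_graph_pullback]
    refine ⟨fun he => hψ ⟨e, he⟩, fun he => ?_⟩
    have := hφ ⟨_, he⟩
    change (γ.symm (γ e.1), γ.symm (γ e.2)) ∈ _ at this
    rwa [γ.symm_apply_apply, γ.symm_apply_apply] at this
  -- The lower inequality is the norm bound for the powers of V⁻¹ and the upper one that for V. The
  -- empty path is handled apart, since the path estimates start at length one.
  · simp only [ContinuousMap.coe_mk, hu]
    rw [one_div_le_prod_div_mul_iff hC (fun i => σ.edgeWeight_pos (μ i)) fun i =>
      pow_pos (norm_pos_iff.2 (right_ne_zero_of_mul_eq_one (hkh (μ i)))) 2,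
      prod_div_mul_le_iff fun i => σ.edgeWeight_pos (μ i)]
    simp only [hk]
    cases n with
    | zero => simpa using hC1
    | succ n =>
      have h1 := prod_le_norm_power_sq V.map hρ hV (fun _ => rfl) (fun _ => rfl)
        (isPath_edgeMap (γ : C(X, Y)) hψ hμ)
      have h2 := prod_le_norm_power_sq V.inv hρ' hW (fun _ => rfl) (fun _ => rfl) hμ
      refine ⟨h2.trans (mul_le_mul_of_nonneg_right (hinv _)
        (Finset.prod_nonneg fun i _ => τ.edgeWeight_nonneg _)), ?_⟩
      have h3 := h1.trans (mul_le_mul_of_nonneg_right (hmap _)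
        (Finset.prod_nonneg fun i _ => σ.edgeWeight_nonneg _))
      simpa only [show ∀ e, φ (edgeMap (γ : C(X, Y)) hψ e) = e from hφψ] using h3

end WPS

theorem mainTheorem4 {X : Type u} {Y : Type v}
    [TopologicalSpace X] [CompactSpace X] [T2Space X] [Nonempty X]
    [TopologicalSpace Y] [CompactSpace Y] [T2Space Y]
    {d d' : ℕ} (σ : WPS d X) (τ : WPS d' Y) (γ : X ≃ₜ Y) :
    (∀ C : ℝ, σ.WeightedOrbitConj τ γ C →
      ∃ V : Similarity (γ.symm.compStarAlgEquiv' ℂ ℂ) σ.corr τ.corr, V.const ≤ C) ∧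
    (∀ V : Similarity (γ.symm.compStarAlgEquiv' ℂ ℂ) σ.corr τ.corr,
      σ.WeightedOrbitConj τ γ V.const) :=
  ⟨fun _ => WPS.exists_similarity_of_weightedOrbitConj, WPS.weightedOrbitConj_of_similarity⟩
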